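/- Let $d\ge 0$ and let $\square^d=\{0,1\}^d$ be the vertex set of the hypercube, with the coordinatewise partial order and its standard simplicial structure (the simplices are the chains $\mathbf u_0\le\dots\le\mathbf u_m$). Let $\mathrm{Chow}_{GS}(\square^d)$ be the graded ring $\mathbb Z[C_{\mathbf v}\mid \mathbf v\in\square^d]/\mathscr I$, with each $C_{\mathbf v}$ of degree one, where $\mathscr I$ is the ideal generated by * $C_{\mathbf v_1}\cdots C_{\mathbf v_m}$ for $m\ge 1$ and $\mathbf v_1,\dots,\mathbf v_m$ not forming a simplex; * $C_{\mathbf u}\sum_{\mathbf v}C_{\mathbf v}$ for all $\mathbf u$; * $C_{\mathbf u}C_{\mathbf w}\sum_{\mathbf v:\,v_i=u_i}C_{\mathbf v}$ for all $\mathbf u,\mathbf w$ and all indices $i$ with $u_i\ne w_i$. There is a unique isomorphism of groups $\deg:\mathrm{Chow}^{d+1}_{GS}(\square^d)\to\mathbb Z$ such that $\deg(C_{\mathbf u_0}\cdots C_{\mathbf u_d})=1$ for all $\mathbf u_0<\dots<\mathbf u_d$ in $\square^d$. Write $|\mathbf v|$ for the number of coordinates of $\mathbf v$ equal to $1$. Let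 $k\ge 1$, let $\mathbf v_1<\dots<\mathbf v_k$ be elements of $\square^d$, let $n_1,\dots,n_k\ge 1$ be integers with $\sum_i n_i=d+1$, and put $C_\sigma=C_{\mathbf v_1}^{n_1}\cdots C_{\mathbf v_k}^{n_k}$. 1. If $n_1+\dots+n_i>|\mathbf v_{i+1}|$ for some $1\le i<k$, or $n_i+\dots+n_k>d-|\mathbf v_{i-1}|$ for some $2\le i\le k$, then $C_\sigma=0$. 2. Otherwise there are non-negative integers $y_0,x_1,y_1,x_2,\dots,y_{k-1},x_k$ with $|\mathbf v_1|=y_0$, with $|\mathbf v_i|=|\mathbf v_{i-1}|+x_{i-1}+y_{i-1}+1$ for $2\le i\le k$ and $n_i=y_{i-1}+x_i+1$ for $1\le i\le k$, and $$\deg(C_\sigma)=(-1)^{d+1-k}\prod_{i=1}^{k}\binom{y_{i-1}+x_i}{y_{i-1}}\prod_{i=1}^{k-1}\binom{x_i+y_i}{x_i}.$$ Moreover, put $n_i$ labelled chips on the point $|\mathbf v_i|$ of $\{0,\dots,d\}$ for each $i$, and let each of these points keep one fixed chip. A chip placement is a bijection from the remaining chips to the free points $\{0,\dots,d\}\setminus\{|\mathbf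 v_1|,\dots,|\mathbf v_k|\}$ such that whenever a chip goes from $|\mathbf v_i|$ to $p$, the closed interval between $p$ and $|\mathbf v_i|$ contains no $|\mathbf v_j|$ with $j\ne i$. In case 1 there is no chip placement. In case 2 the product of binomial coefficients above is the number of chip placements up to permuting chips that go from the same point to the same side of it; equivalently, the number of chip placements in which such chips are laid down from left to right in the order of their labels. -/

import Mathlib

open scoped BigOperators

universe u

namespace GrossSchoen

section Product

variable {d : ℕ} {V : Fin d → Type u} [∀ i, LinearOrder (V i)]

/-- A pair of vertices `a ≤ b` of the product `G 1 × ⋯ × G d` is a 1-simplex if each coordinate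
is either unchanged or moves along an edge. -/
def IsOneSimplex (G : ∀ i, SimpleGraph (V i)) (a b : ∀ i, V i) : Prop :=
  a ≤ b ∧ ∀ i, a i < b i → (G i).Adj (a i) (b i)

/-- The set `I(a, b)` of the coordinates which strictly increase from `a` to `b`. -/
def increase (a b : ∀ i, V i) : Set (Fin d) :=
  {i | a i < b i}

/-- The (possibly degenerate) `k`-simplices `σ 0 ≤ ⋯ ≤ σ k` of the product of the graphs. -/
structure IsSimplex (G : ∀ i, SimpleGraph (V i)) {k : ℕ} (σ : Fin (k + 1) → ∀ i, V i) : Prop where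
  edge : ∀ j : Fin k, IsOneSimplex G (σ j.castSucc) (σ j.succ)
  disjoint : ∀ j j' : Fin k, j ≠ j' →
    Disjoint (increase (σ j.castSucc) (σ j.succ)) (increase (σ j'.castSucc) (σ j'.succ))

/-- The non-degenerate `k`-simplices `σ 0 < ⋯ < σ k`. -/
def IsNondegenerateSimplex (G : ∀ i, SimpleGraph (V i)) {k : ℕ}
    (σ : Fin (k + 1) → ∀ i, V i) : Prop :=
  IsSimplex G σ ∧ StrictMono σ

/-- A nonempty finite family of vertices forms a simplex if it is one after reordering. -/
def FormsSimplex (G : ∀ i, SimpleGraph (V i)) {k : ℕ} (w : Fin (k + 1) → ∀ i, V i) : Prop :=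
  ∃ π : Equiv.Perm (Fin (k + 1)), IsSimplex G (w ∘ π)

variable [∀ i, Fintype (V i)]

open MvPolynomial in
/-- The three families of generators of the ideal of elements rationally equivalent to zero. -/
inductive RatGenerator (G : ∀ i, SimpleGraph (V i)) : MvPolynomial (∀ i, V i) ℤ → Prop
  | nonSimplex {k : ℕ} (w : Fin (k + 1) → ∀ i, V i) (hw : ¬ FormsSimplex G w) :
      RatGenerator G (∏ j, X (w j))
  | total (a : ∀ i, V i) :
      RatGenerator G (X a * ∑ b, X b)
  | slice (a b : ∀ i, V i) (i : Fin d) (h : a i ≠ b i) :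
      RatGenerator G (X a * X b * ∑ c with c i = a i, X c)

/-- The ideal of elements rationally equivalent to zero. -/
noncomputable def ratIdeal (G : ∀ i, SimpleGraph (V i)) : Ideal (MvPolynomial (∀ i, V i) ℤ) :=
  Ideal.span {p | RatGenerator G p}

/-- The combinatorial Chow ring of the product of the graphs `G i`. -/
abbrev ChowRing (G : ∀ i, SimpleGraph (V i)) : Type u :=
  MvPolynomial (∀ i, V i) ℤ ⧸ ratIdeal G

/-- The degree `m` piece of the Chow ring: the classes of homogeneous polynomials of degree `m`. -/
noncomputable def chowPiece (G : ∀ i, SimpleGraph (V i)) (m : ℕ) : Submodule ℤ (ChowRing G) :=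
  (MvPolynomial.homogeneousSubmodule (∀ i, V i) ℤ m).map
    (Ideal.Quotient.mkₐ ℤ (ratIdeal G)).toLinearMap

/-- The class `C_a` of a vertex `a`. -/
noncomputable def vertexClass (G : ∀ i, SimpleGraph (V i)) (a : ∀ i, V i) : ChowRing G :=
  Ideal.Quotient.mk (ratIdeal G) (MvPolynomial.X a)

theorem prod_vertexClass_pow_mem (G : ∀ i, SimpleGraph (V i)) {k m : ℕ}
    (w : Fin k → ∀ i, V i) (n : Fin k → ℕ) (h : ∑ j, n j = m) :
    ∏ j, vertexClass G (w j) ^ n j ∈ chowPiece G m := by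
  refine ⟨∏ j, MvPolynomial.X (w j) ^ n j, ?_, by simp [vertexClass]⟩
  rw [SetLike.mem_coe, MvPolynomial.mem_homogeneousSubmodule, ← h]
  refine MvPolynomial.IsHomogeneous.prod _ _ _ fun j _ => ?_
  simpa using (MvPolynomial.isHomogeneous_X ℤ (w j)).pow (n j)

/-- The monomial `∏ C_{w j} ^ n j`, as an element of the graded piece of degree `m = ∑ n j`. -/
noncomputable def monomialClass (G : ∀ i, SimpleGraph (V i)) {k m : ℕ}
    (w : Fin k → ∀ i, V i) (n : Fin k → ℕ) (h : ∑ j, n j = m) : chowPiece G m :=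
  ⟨∏ j, vertexClass G (w j) ^ n j, prod_vertexClass_pow_mem G w n h⟩

/-- The class `C_σ` of a `k`-simplex, as an element of the graded piece of degree `k + 1`. -/
noncomputable def simplexClass (G : ∀ i, SimpleGraph (V i)) {k : ℕ} (σ : Fin (k + 1) → ∀ i, V i) :
    chowPiece G (k + 1) :=
  monomialClass G σ (fun _ => 1) (by simp)

end Product

/-- The vertices of the hypercube `□^d`. -/
abbrev Cube (d : ℕ) : Type := Fin d → Fin 2

/-- The hypercube `□^d` as the product of `d` copies of the complete graph on `0 < 1`. -/
abbrev cubeGraphs (d : ℕ) : ∀ _ : Fin d, SimpleGraph (Fin 2) := fun _ => ⊤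

/-- The length `|a|`: the number of coordinates equal to one. -/
def length {d : ℕ} (a : Cube d) : ℕ :=
  (Finset.univ.filter fun i => a i = 1).card

/-- An isomorphism from the top graded piece of `Chow_GS(□^d)` to `ℤ` is the degree map if it
sends the class of every non-degenerate `d`-simplex to `1`. -/
def IsDegreeMap (d : ℕ) (deg : chowPiece (cubeGraphs d) (d + 1) ≃ₗ[ℤ] ℤ) : Prop :=
  ∀ σ : Fin (d + 1) → Cube d, IsNondegenerateSimplex (cubeGraphs d) σ →
    deg (simplexClass (cubeGraphs d) σ) = 1

/-- Some initial sum of the exponents exceeds the length of the next vertex, or some final sum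
exceeds the colength of the previous vertex. -/
def Overflows {d k : ℕ} (v : Fin (k + 1) → Cube d) (n : Fin (k + 1) → ℕ) : Prop :=
  (∃ i : Fin k, length (v i.succ) < ∑ j ∈ Finset.Iic i.castSucc, n j) ∨
  (∃ i : Fin k, (d : ℤ) - length (v i.castSucc) < ∑ j ∈ Finset.Ici i.succ, (n j : ℤ))

section Chips

variable {k : ℕ}

/-- The occupied point `l i` is a neighbor of `p` if no other occupied point lies in the interval
formed by `p` and `l i`. -/
def IsNeighbor (l : Fin (k + 1) → ℕ) (i : Fin (k + 1)) (p : ℕ) : Prop :=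
  ∀ j, l j ∈ Set.uIcc p (l i) → l j = l i

/-- The labelled chips remaining when each occupied point `l i` keeps one of its `n i` chips. -/
abbrev ExtraChip (n : Fin (k + 1) → ℕ) : Type := Σ i, Fin (n i - 1)

/-- The points of `{0, …, d}` which are not occupied. -/
abbrev FreePoint (d : ℕ) (l : Fin (k + 1) → ℕ) : Type := {p : Fin (d + 1) // ∀ i, l i ≠ p}

/-- The ways of handing all the extra chips to the free points, one chip to each free point, such
that every chip goes to a point neighboring the one it comes from. -/
def chipPlacements (d : ℕ) (l n : Fin (k + 1) → ℕ) : Set (ExtraChip n ≃ FreePoint d l) :=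
  {f | ∀ c, IsNeighbor l c.1 ((f c).1 : ℕ)}

/-- The chip placements in which the chips going from the same point to the same side are laid
down from left to right in the order of their labels; these represent the chip placements up to
permutations of the chips which go from the same point to the same side. -/
def orderedChipPlacements (d : ℕ) (l n : Fin (k + 1) → ℕ) : Set (ExtraChip n ≃ FreePoint d l) :=
  {f | f ∈ chipPlacements d l n ∧ ∀ (i : Fin (k + 1)) (a b : Fin (n i - 1)), a < b →
    (((f ⟨i, a⟩).1 : ℕ) < l i ↔ ((f ⟨i, b⟩).1 : ℕ) < l i) →
    (f ⟨i, a⟩).1 < (f ⟨i, b⟩).1}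

end Chips

end GrossSchoen

/-! The degree is constructed directly from the closed formula. To a strict chain with positive
multiplicities attach the signed product of binomials of the statement, with the binomials extended
by zero to negative arguments so that the overflowing chains get the value zero (`chainWeight`). To
a monomial whose support is not a chain attach zero. This defines a `ℤ`-linear functional
`degFunctional` on polynomials.

The functional kills the ideal. For the two linear families of generators this is a statement about
the sum of the values over all ways to insert one more vertex `v` into a fixed chain. The essential
identity is `sum_weight_insertVertex`: inserting a vertex anywhere above `a` amounts, after
summation, to one more chip going from `a` to the right. With respect to the next vertex `b` of the
chain, `v` lies below `b`, equals `b` (which raises a multiplicity and flips a sign), or lies above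
`b`. The first contribution is counted by a level of a Boolean interval, the last by induction, and
Pascal's rule combines the three. The same cancellation gives zero for the sum over all `v`
(`sum_chainWeight_insertVertex`) and for the sum over `v` with a prescribed coordinate that changes
along the chain (`sum_chainWeight_insertVertex_slice`).

Conversely the top graded piece is generated by one maximal chain. The difference of two relations
trades a repeated vertex for new ones (`monoClass_mem_span`), so squarefree monomials on chains
suffice, and these are maximal chains. Two maximal chains differing in one vertex have the same
class, again by a difference of two relations, and adjacent transpositions connect all of them
(`monoClass_permExponents`). Since the functional is `1` on maximal chains, it induces the unique
degree isomorphism. In the overflowing case the degree vanishes, and injectivity makes the class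
itself vanish.

For the chips, each free point lies in a gap and can only be served by the occupied points bounding
that gap. Conservation of chips and points then forces how many chips go to each side
(`card_eq_leftChips`). An ordered placement is the same as a choice, at each occupied point, of the
chips going left, and in each gap, of the points served from the left. This gives the two products
of binomials (`ncard_orderedChipPlacements`). -/

namespace GrossSchoen

/-! ### Binomial coefficients with integer arguments -/

/-- The binomial coefficient `(a + b)! / (a! b!)`, extended by zero to negative arguments. -/
def binomMix (a b : ℤ) : ℤ :=
  if 0 ≤ a ∧ 0 ≤ b then ((a + b).toNat.choose a.toNat : ℤ) else 0

theorem binomMix_natCast (a b : ℕ) : binomMix a b = ((a + b).choose a : ℕ) := by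
  have : ((a : ℤ) + b).toNat = a + b := by omega
  simp [binomMix, this]

theorem binomMix_of_neg_left {a b : ℤ} (h : a < 0) : binomMix a b = 0 :=
  if_neg fun h' => absurd h'.1 (by omega)

theorem binomMix_of_neg_right {a b : ℤ} (h : b < 0) : binomMix a b = 0 :=
  if_neg fun h' => absurd h'.2 (by omega)

theorem binomMix_zero_left {b : ℤ} (h : 0 ≤ b) : binomMix 0 b = 1 := by
  simp [binomMix, h]

theorem binomMix_zero_right {a : ℤ} (h : 0 ≤ a) : binomMix a 0 = 1 := by
  simp [binomMix, h]

/-- A vertex of multiplicity one has no chip to give away, so its numbers of chips going left and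
right are opposite. This indicator is its binomial factor. -/
theorem binomMix_neg_self (a : ℤ) : binomMix a (-a) = if a = 0 then 1 else 0 := by
  rcases lt_trichotomy a 0 with h | h | h
  · rw [binomMix_of_neg_left h, if_neg h.ne]
  · subst h; simp [binomMix]
  · rw [binomMix_of_neg_right (by omega), if_neg h.ne']

/-- Extension by zero makes Pascal's rule hold on the boundary too; the hypothesis serves to exclude
the origin, the only point where it fails. -/
theorem binomMix_pascal {a b : ℤ} (h : 1 ≤ a + b) :
    binomMix a b = binomMix (a - 1) b + binomMix a (b - 1) := by
  rcases lt_or_ge a 0 with ha | ha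
  · simp [binomMix_of_neg_left, ha, show a - 1 < 0 by omega]
  rcases lt_or_ge b 0 with hb | hb
  · simp [binomMix_of_neg_right, hb, show b - 1 < 0 by omega]
  lift a to ℕ using ha
  lift b to ℕ using hb
  rcases a with _ | a
  · rw [binomMix_of_neg_left (a := ((0 : ℕ) : ℤ) - 1) (by simp)]
    simp only [Nat.cast_zero, zero_add]
    rw [binomMix_zero_left (by omega), binomMix_zero_left (by omega)]
  rcases b with _ | b
  · rw [binomMix_of_neg_right (b := ((0 : ℕ) : ℤ) - 1) (by simp)]
    simp only [Nat.cast_zero, add_zero]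
    rw [binomMix_zero_right (by omega), binomMix_zero_right (by omega)]
  · have h1 : ((a + 1 : ℕ) : ℤ) - 1 = a := by push_cast; ring
    have h2 : ((b + 1 : ℕ) : ℤ) - 1 = b := by push_cast; ring
    rw [h1, h2, binomMix_natCast, binomMix_natCast, binomMix_natCast]
    norm_cast
    rw [show a + 1 + (b + 1) = (a + b + 1) + 1 by ring, Nat.choose_succ_succ]
    congr 2
    ring

/-! ### Lengths and intervals in the cube -/

section Cube

open scoped Classical

variable {d : ℕ}

/-- The set of coordinates equal to one. -/
def ones (a : Cube d) : Finset (Fin d) := Finset.univ.filter fun i => a i = 1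

theorem mem_ones {a : Cube d} {i : Fin d} : i ∈ ones a ↔ a i = 1 := by simp [ones]

theorem card_ones (a : Cube d) : (ones a).card = length a := rfl

theorem ones_subset_ones {a b : Cube d} : ones a ⊆ ones b ↔ a ≤ b := by
  constructor
  · intro h i
    by_cases hi : a i = 1
    · rw [hi, mem_ones.1 (h (mem_ones.2 hi))]
    · have : a i = 0 := by omega
      rw [this]; exact Fin.zero_le _
  · intro h i hi
    rw [mem_ones] at hi ⊢
    have := h i
    rw [hi] at this
    exact le_antisymm (Fin.le_last _) this

theorem ones_injective : Function.Injective (ones (d := d)) := fun _ _ h =>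
  le_antisymm (ones_subset_ones.1 h.le) (ones_subset_ones.1 h.ge)

theorem ones_indicator (s : Finset (Fin d)) : ones (fun i => if i ∈ s then 1 else 0) = s := by
  ext i; simp [mem_ones]

theorem length_mono {a b : Cube d} (h : a ≤ b) : length a ≤ length b :=
  Finset.card_le_card (ones_subset_ones.2 h)

theorem length_strictMono {a b : Cube d} (h : a < b) : length a < length b := by
  refine Finset.card_lt_card ⟨ones_subset_ones.2 h.le, fun h' => ?_⟩
  exact h.not_ge (ones_subset_ones.1 h')

theorem length_le (a : Cube d) : length a ≤ d := by
  simpa [card_ones] using Finset.card_le_univ (ones a)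

theorem eq_of_le_of_length_le {a b : Cube d} (h : a ≤ b) (h' : length b ≤ length a) : a = b := by
  by_contra hne
  exact absurd (length_strictMono (lt_of_le_of_ne h hne)) (by omega)

theorem length_zero : length (0 : Cube d) = 0 := by simp [length]

theorem length_one : length (1 : Cube d) = d := by simp [length]

theorem le_one_cube (a : Cube d) : a ≤ 1 := fun i => by
  exact Fin.le_last _

theorem zero_le_cube (a : Cube d) : 0 ≤ a := fun _ => Fin.zero_le _

/-- The interval is the Boolean lattice on the coordinates in `ones b \ ones a`, and its vertices at
height `q` are the `q`-element subsets. -/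
theorem card_between {a b : Cube d} (h : a ≤ b) (q : ℕ) :
    (Finset.univ.filter fun v : Cube d => a ≤ v ∧ v ≤ b ∧ length v = length a + q).card =
      (length b - length a).choose q := by
  have hab := ones_subset_ones.2 h
  have hc : (ones b \ ones a).card = length b - length a := by
    rw [Finset.card_sdiff_of_subset hab]; rfl
  rw [← hc, ← Finset.card_powersetCard]
  refine Finset.card_bij (fun v _ => ones v \ ones a) ?_ ?_ ?_
  · intro v hv
    simp only [Finset.mem_filter, Finset.mem_univ, true_and] at hv
    rw [Finset.mem_powersetCard]
    refine ⟨Finset.sdiff_subset_sdiff (ones_subset_ones.2 hv.2.1) le_rfl, ?_⟩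
    rw [Finset.card_sdiff_of_subset (ones_subset_ones.2 hv.1), card_ones, card_ones]
    omega
  · intro v hv w hw hvw
    simp only [Finset.mem_filter, Finset.mem_univ, true_and] at hv hw
    apply ones_injective
    rw [← Finset.sdiff_union_of_subset (ones_subset_ones.2 hv.1), hvw,
      Finset.sdiff_union_of_subset (ones_subset_ones.2 hw.1)]
  · intro s hs
    rw [Finset.mem_powersetCard] at hs
    have hdisj : Disjoint s (ones a) :=
      Finset.disjoint_of_subset_left hs.1 Finset.sdiff_disjoint
    refine ⟨fun i => if i ∈ s ∪ ones a then 1 else 0, ?_, ?_⟩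
    · simp only [Finset.mem_filter, Finset.mem_univ, true_and]
      rw [← ones_subset_ones, ← ones_subset_ones, ← card_ones, ones_indicator]
      refine ⟨Finset.subset_union_right, Finset.union_subset
        (hs.1.trans Finset.sdiff_subset) hab, ?_⟩
      rw [Finset.card_union_of_disjoint hdisj, card_ones]
      omega
    · rw [ones_indicator, Finset.union_sdiff_right, Finset.sdiff_eq_self_of_disjoint hdisj]

theorem length_update_one {a : Cube d} {i : Fin d} (h : a i = 0) :
    length (Function.update a i 1) = length a + 1 := by
  have : ones (Function.update a i 1) = insert i (ones a) := by
    ext j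
    by_cases hj : j = i
    · subst hj; simp [mem_ones]
    · simp [mem_ones, hj]
  rw [← card_ones, this, Finset.card_insert_of_notMem (by simp [mem_ones, h]), card_ones]

theorem update_one_le_iff {a v : Cube d} {i : Fin d} :
    Function.update a i 1 ≤ v ↔ (∀ j, j ≠ i → a j ≤ v j) ∧ v i = 1 := by
  rw [update_le_iff, and_comm]
  exact and_congr_right fun _ => ⟨fun h => le_antisymm (Fin.le_last _) h, fun h => h.ge⟩

end Cube

/-! ### The weight of a chain and its behaviour under insertion of a vertex -/

section Weight

open scoped Classical

/-- The signed weight of a chain of vertices with multiplicities above `a`, when `x` chips go from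
`a` to the right. -/
noncomputable def weight {d : ℕ} : Cube d → ℤ → List (Cube d × ℕ) → ℤ
  | a, x, [] => if x = d - length a then 1 else 0
  | a, x, p :: t =>
    if a < p.1 then
      binomMix x (length p.1 - length a - 1 - x) *
        ((-1) ^ (p.2 + 1) * binomMix (length p.1 - length a - 1 - x)
          (p.2 - 1 - (length p.1 - length a - 1 - x))) *
        weight p.1 (p.2 - 1 - (length p.1 - length a - 1 - x)) t
    else 0

/-- The signed weight of a chain of vertices with multiplicities. -/
noncomputable def chainWeight {d : ℕ} : List (Cube d × ℕ) → ℤ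
  | [] => 0
  | p :: t => (-1) ^ (p.2 + 1) * binomMix (length p.1) (p.2 - 1 - length p.1) *
      weight p.1 (p.2 - 1 - length p.1) t

/-- Insertion of a vertex into a chain of vertices with multiplicities. -/
noncomputable def insertVertex {d : ℕ} (v : Cube d) : List (Cube d × ℕ) → List (Cube d × ℕ)
  | [] => [(v, 1)]
  | p :: t =>
    if v = p.1 then (p.1, p.2 + 1) :: t
    else if v < p.1 then (v, 1) :: p :: t
    else p :: insertVertex v t

variable {d : ℕ}

theorem weight_cons_of_lt {a b : Cube d} (h : a < b) (x y : ℤ) (n : ℕ) (t : List (Cube d × ℕ))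
    (hy : y = length b - length a - 1 - x) :
    weight a x ((b, n) :: t) =
      binomMix x y * ((-1) ^ (n + 1) * binomMix y (n - 1 - y)) * weight b (n - 1 - y) t := by
  subst hy
  rw [weight, if_pos h]

theorem weight_cons_of_not_lt {a b : Cube d} (h : ¬ a < b) (x : ℤ) (n : ℕ)
    (t : List (Cube d × ℕ)) : weight a x ((b, n) :: t) = 0 := by
  rw [weight, if_neg h]

/-- This permits sums over all vertices `v` of the cube where only those above `a` matter. -/
theorem weight_insertVertex_of_not_lt {a v : Cube d} (h : ¬ a < v) (x : ℤ)
    (L : List (Cube d × ℕ)) : weight a x (insertVertex v L) = 0 := by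
  induction L generalizing a x with
  | nil => exact weight_cons_of_not_lt h _ _ _
  | cons p t ih =>
    obtain ⟨b, n⟩ := p
    rw [insertVertex]
    split_ifs with h1 h2
    · exact weight_cons_of_not_lt (h1 ▸ h) _ _ _
    · exact weight_cons_of_not_lt h _ _ _
    · by_cases hab : a < b
      · rw [weight_cons_of_lt hab _ _ _ _ rfl, ih (fun h3 => h (hab.trans h3)), mul_zero]
      · exact weight_cons_of_not_lt hab _ _ _

/-- The weight of a chain with a new simple vertex in the first gap. -/
theorem weight_cons_cons {a b v : Cube d} (hav : a < v) (hvb : v < b) {x : ℤ} (hx : 0 ≤ x) (n : ℕ)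
    (t : List (Cube d × ℕ)) (y : ℤ) (hy : y = length b - length a - 1 - x) :
    weight a x ((v, 1) :: (b, n) :: t) =
      if (length v : ℤ) = length a + 1 + x then
        (-1) ^ (n + 1) * binomMix (y - 1) (n - y) * weight b (n - y) t else 0 := by
  rw [weight_cons_of_lt hav _ _ _ _ rfl]
  -- A simple vertex emits no chips, so the gap between `a` and `v` must consist of exactly the `x`
  -- points served from `a`.
  have h0 : (((1 : ℕ) : ℤ) - 1 - (length v - length a - 1 - x)) =
    -((length v : ℤ) - length a - 1 - x) := by push_cast; ring
  rw [h0, binomMix_neg_self]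
  by_cases h : (length v : ℤ) = length a + 1 + x
  · have h1 : (length v : ℤ) - length a - 1 - x = 0 := by omega
    have h2 := length_strictMono hvb
    rw [if_pos h, if_pos h1, h1, neg_zero, weight_cons_of_lt hvb 0 (y - 1) _ _ (by omega),
      binomMix_zero_right hx, binomMix_zero_left (by omega),
      show (n : ℤ) - 1 - (y - 1) = n - y by ring]
    ring
  · rw [if_neg h, if_neg (by omega)]
    ring

/-- The three terms are the positions of `v` relative to `b`: below, equal, above. By `hF` the last
sum may run over all `v`, which makes it accessible to induction. -/
theorem sum_insertVertex_cons (F : List (Cube d × ℕ) → ℤ) (P : Cube d → Prop) [DecidablePred P]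
    (b : Cube d) (n : ℕ) (t : List (Cube d × ℕ))
    (hF : ∀ v, ¬ b < v → F ((b, n) :: insertVertex v t) = 0) :
    ∑ v with P v, F (insertVertex v ((b, n) :: t)) =
      ∑ v with P v ∧ v < b, F ((v, 1) :: (b, n) :: t) +
      (if P b then F ((b, n + 1) :: t) else 0) +
      ∑ v with P v, F ((b, n) :: insertVertex v t) := by
  have hb : (if P b then F ((b, n + 1) :: t) else 0) =
      ∑ v with P v, if v = b then F ((b, n + 1) :: t) else 0 := by
    rw [Finset.sum_ite_eq']
    simp
  rw [hb, ← Finset.filter_filter, Finset.sum_filter (fun v => v < b), ← Finset.sum_add_distrib,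
    ← Finset.sum_add_distrib]
  refine Finset.sum_congr rfl fun v _ => ?_
  rw [insertVertex]
  by_cases h1 : v = b
  · subst h1
    simp [hF v (lt_irrefl v)]
  · by_cases h2 : v < b
    · simp [h1, h2, hF v h2.not_gt]
    · simp [h1, h2]

/-- The sum of the weights over the new simple vertices in the first gap. -/
theorem sum_weight_gap (P : Cube d → Prop) [DecidablePred P] {a b : Cube d} {x : ℤ} (hx : 0 ≤ x)
    (n : ℕ) (t : List (Cube d × ℕ)) (y : ℤ) (hy : y = length b - length a - 1 - x) :
    ∑ v with P v ∧ v < b, weight a x ((v, 1) :: (b, n) :: t) =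
      (Finset.univ.filter fun v =>
        P v ∧ a ≤ v ∧ v ≤ b ∧ length v = length a + (x.toNat + 1)).card *
        ((-1) ^ (n + 1) * binomMix (y - 1) (n - y) * weight b (n - y) t) := by
  -- For `y = 0` the level counted on the right is that of `b`, which the sum on the left omits; the
  -- factor `binomMix (y - 1)` vanishes there.
  rcases lt_or_ge y 1 with hy1 | hy1
  · rw [binomMix_of_neg_left (a := y - 1) (by omega)]
    simp only [mul_zero, zero_mul]
    refine Finset.sum_eq_zero fun v hv => ?_
    simp only [Finset.mem_filter, Finset.mem_univ, true_and] at hv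
    by_cases hav : a < v
    · rw [weight_cons_cons hav hv.2 hx n t y hy, binomMix_of_neg_left (a := y - 1) (by omega)]
      simp
    · exact weight_cons_of_not_lt hav _ _ _
  · lift x to ℕ using hx
    rw [Int.toNat_natCast, ← nsmul_eq_mul, ← Finset.sum_const, Finset.sum_filter,
      Finset.sum_filter]
    refine Finset.sum_congr rfl fun v _ => ?_
    by_cases hP : P v
    · simp only [hP, true_and]
      by_cases hvb : v < b
      · rw [if_pos hvb]
        by_cases hav : a < v
        · rw [weight_cons_cons hav hvb (by omega) n t y hy]
          have : (length v : ℤ) = length a + 1 + x ↔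
              a ≤ v ∧ v ≤ b ∧ length v = length a + (x + 1) := by
            constructor
            · intro h; exact ⟨hav.le, hvb.le, by omega⟩
            · rintro ⟨_, _, h⟩; omega
          simp only [this]
        · rw [weight_cons_of_not_lt hav, if_neg]
          rintro ⟨h1, h2, h3⟩
          refine hav (lt_of_le_of_ne h1 ?_)
          rintro rfl
          omega
      · rw [if_neg hvb, if_neg]
        rintro ⟨h1, h2, h3⟩
        refine hvb (lt_of_le_of_ne h2 ?_)
        rintro rfl
        omega
    · simp [hP]

/-- The effect of an additional vertex above `a` is an additional chip from `a` to the right. -/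
theorem sum_weight_insertVertex {a : Cube d} {x : ℤ} (hx : 0 ≤ x) (L : List (Cube d × ℕ))
    (hL : ∀ p ∈ L, 1 ≤ p.2) :
    ∑ v, weight a x (insertVertex v L) = weight a (x + 1) L := by
  induction L generalizing a x with
  | nil =>
    -- A simple vertex at the end of a chain sends nothing to the right, so no point may remain
    -- beyond it: only the top vertex contributes.
    have key : ∀ v : Cube d, weight a x (insertVertex v []) =
        if v = 1 then weight a (x + 1) [] else 0 := by
      intro v
      rw [insertVertex]
      by_cases hav : a < v
      · rw [weight_cons_of_lt hav _ _ _ _ rfl]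
        have h0 : (((1 : ℕ) : ℤ) - 1 - (length v - length a - 1 - x)) =
          -((length v : ℤ) - length a - 1 - x) := by push_cast; ring
        rw [h0, binomMix_neg_self, weight, weight]
        have hvd := length_le v
        by_cases hv : v = 1
        · subst hv
          rw [length_one]
          by_cases h : x + 1 = d - length a
          · have h1 : (d : ℤ) - length a - 1 - x = 0 := by omega
            simp [h1, h, binomMix_zero_right hx]
          · have h1 : ¬ (d : ℤ) - length a - 1 - x = 0 := by omega
            simp [h1, h]
        · have : length v ≠ d := fun h =>
            hv (eq_of_le_of_length_le (le_one_cube v) (by rw [length_one]; omega))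
          by_cases h1 : (length v : ℤ) - length a - 1 - x = 0
          · have h2 : ¬ (0 : ℤ) = d - length v := by omega
            simp [h1, h2, hv]
          · simp [h1, hv]
      · rw [weight_cons_of_not_lt hav]
        split_ifs with h
        · subst h
          have : a = 1 := by
            by_contra h'
            exact hav (lt_of_le_of_ne (le_one_cube a) h')
          rw [weight, if_neg]
          rw [this, length_one]; omega
        · rfl
    rw [Finset.sum_congr rfl fun v _ => key v]
    simp
  | cons p t ih =>
    obtain ⟨b, n⟩ := p
    by_cases hab : a < b
    · have hn : 1 ≤ n := hL (b, n) (by simp)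
      have hlen := length_strictMono hab
      obtain ⟨y, hy⟩ : ∃ y : ℤ, y = length b - length a - 1 - x := ⟨_, rfl⟩
      have hF : ∀ v, ¬ b < v → weight a x ((b, n) :: insertVertex v t) = 0 := by
        intro v hv
        rw [weight_cons_of_lt hab _ _ _ _ rfl, weight_insertVertex_of_not_lt hv, mul_zero]
      have key := sum_insertVertex_cons (weight a x) (fun _ => True) b n t hF
      simp only [Finset.filter_true, true_and, if_true] at key
      rw [key]
      have gap : ∑ v with v < b, weight a x ((v, 1) :: (b, n) :: t) =
          binomMix (x + 1) y *
            ((-1) ^ (n + 1) * binomMix (y - 1) (n - y) * weight b (n - y) t) := by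
        have h := sum_weight_gap (fun _ => True) hx n t y hy
        simp only [true_and] at h
        rw [h]
        rcases lt_or_ge y 1 with hy1 | hy1
        · rw [binomMix_of_neg_left (a := y - 1) (by omega)]
          ring
        · lift x to ℕ using hx
          lift y to ℕ using (by omega)
          rw [Int.toNat_natCast, card_between hab.le,
            show length b - length a = x + 1 + y by omega,
            show (x : ℤ) + 1 = ((x + 1 : ℕ) : ℤ) by push_cast; ring, binomMix_natCast]
      have above : ∑ v, weight a x ((b, n) :: insertVertex v t) =
          binomMix x y * ((-1) ^ (n + 1) * binomMix y (n - 1 - y)) * weight b (n - y) t := by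
        simp only [weight_cons_of_lt hab x y n _ hy]
        rw [← Finset.mul_sum]
        -- The induction hypothesis needs a nonnegative number of chips; otherwise the binomial
        -- factor of `b` is zero.
        rcases lt_or_ge ((n : ℤ) - 1 - y) 0 with h | h
        · rw [binomMix_of_neg_right h]; ring
        · rw [ih h fun p hp => hL p (by simp [hp])]
          ring_nf
      rw [gap, above, weight_cons_of_lt hab x y (n + 1) t hy,
        weight_cons_of_lt hab (x + 1) (y - 1) n t (by omega)]
      have e1 : (((n + 1 : ℕ) : ℤ) - 1 - y) = n - y := by push_cast; ring
      have e2 : ((n : ℤ) - 1 - (y - 1)) = n - y := by ring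
      have e3 : ((n : ℤ) - y - 1) = n - 1 - y := by ring
      -- `p1` merges the terms `v = b` and `v > b`, which carry opposite signs, into a multiple of
      -- `binomMix (y - 1) (n - y)`. This is also the factor of the gap term, and `p2` then turns
      -- `binomMix (x + 1) y - binomMix x y` into `binomMix (x + 1) (y - 1)`.
      have p1 := binomMix_pascal (a := y) (b := n - y) (by omega)
      have p2 := binomMix_pascal (a := x + 1) (b := y) (by omega)
      rw [e3] at p1
      rw [add_sub_cancel_right] at p2
      rw [e1, e2, p1, p2, pow_succ _ (n + 1)]
      ring
    · rw [weight_cons_of_not_lt hab]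
      refine Finset.sum_eq_zero fun v _ => ?_
      rw [insertVertex]
      split_ifs with h1 h2
      · exact weight_cons_of_not_lt hab _ _ _
      · exact weight_cons_of_not_lt (fun h => hab (h.trans h2)) _ _ _
      · exact weight_cons_of_not_lt hab _ _ _

/-- Vertices with a fixed coordinate equal to one contribute zero in total if that coordinate
changes along the chain. -/
theorem sum_weight_insertVertex_slice {a : Cube d} {x : ℤ} (hx : 0 ≤ x) (i : Fin d) (ha : a i = 0)
    (L : List (Cube d × ℕ)) (hL : ∀ p ∈ L, 1 ≤ p.2) (hi : ∃ p ∈ L, p.1 i = 1) :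
    ∑ v with v i = 1, weight a x (insertVertex v L) = 0 := by
  induction L generalizing a x with
  | nil => simp at hi
  | cons p t ih =>
    obtain ⟨b, n⟩ := p
    by_cases hab : a < b
    · have hn : 1 ≤ n := hL (b, n) (by simp)
      have hlen := length_strictMono hab
      obtain ⟨y, hy⟩ : ∃ y : ℤ, y = length b - length a - 1 - x := ⟨_, rfl⟩
      have hF : ∀ v, ¬ b < v → weight a x ((b, n) :: insertVertex v t) = 0 := by
        intro v hv
        rw [weight_cons_of_lt hab _ _ _ _ rfl, weight_insertVertex_of_not_lt hv, mul_zero]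
      have ht : ∀ p ∈ t, 1 ≤ p.2 := fun p hp => hL p (by simp [hp])
      rw [sum_insertVertex_cons (weight a x) (fun v => v i = 1) b n t hF]
      by_cases hb : b i = 1
      · have gap : ∑ v with v i = 1 ∧ v < b, weight a x ((v, 1) :: (b, n) :: t) =
            binomMix x y * ((-1) ^ (n + 1) * binomMix (y - 1) (n - y) * weight b (n - y) t) := by
          rw [sum_weight_gap (fun v => v i = 1) hx n t y hy]
          rcases lt_or_ge y 1 with hy1 | hy1
          · rw [binomMix_of_neg_left (a := y - 1) (by omega)]
            ring
          · lift x to ℕ using hx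
            lift y to ℕ using (by omega)
            -- The vertices between `a` and `b` with `i`-th coordinate one form an interval of rank
            -- one less, so the gap term carries `binomMix x y` instead of `binomMix (x + 1) y`.
            -- This makes the three terms cancel with a single use of Pascal's rule.
            have hle : Function.update a i 1 ≤ b := update_one_le_iff.2 ⟨fun j _ => hab.le j, hb⟩
            have hcard := card_between hle x
            rw [length_update_one ha] at hcard
            rw [Int.toNat_natCast, binomMix_natCast,
              show x + y = length b - (length a + 1) by omega,
              ← hcard]
            congr 3
            ext v
            simp only [Finset.mem_filter, Finset.mem_univ, true_and, update_one_le_iff]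
            constructor
            · rintro ⟨h1, h2, h3, h4⟩
              exact ⟨⟨fun j _ => h2 j, h1⟩, h3, by omega⟩
            · rintro ⟨⟨h1, h2⟩, h3, h4⟩
              refine ⟨h2, fun j => ?_, h3, by omega⟩
              by_cases hj : j = i
              · subst hj; rw [ha]; exact Fin.zero_le _
              · exact h1 j hj
        have above : ∑ v with v i = 1, weight a x ((b, n) :: insertVertex v t) =
            binomMix x y * ((-1) ^ (n + 1) * binomMix y (n - 1 - y)) * weight b (n - y) t := by
          have : ∑ v with v i = 1, weight a x ((b, n) :: insertVertex v t) =
              ∑ v, weight a x ((b, n) :: insertVertex v t) := by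
            refine Finset.sum_subset (Finset.filter_subset _ _) fun v _ hv => hF v fun hbv => hv ?_
            simp only [Finset.mem_filter, Finset.mem_univ, true_and]
            exact le_antisymm (Fin.le_last _) (hb ▸ hbv.le i)
          rw [this]
          simp only [weight_cons_of_lt hab x y n _ hy]
          rw [← Finset.mul_sum]
          rcases lt_or_ge ((n : ℤ) - 1 - y) 0 with h | h
          · rw [binomMix_of_neg_right h]; ring
          · rw [sum_weight_insertVertex h _ ht]
            ring_nf
        rw [gap, above, if_pos hb, weight_cons_of_lt hab x y (n + 1) t hy]
        have e1 : (((n + 1 : ℕ) : ℤ) - 1 - y) = n - y := by push_cast; ring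
        have e3 : ((n : ℤ) - y - 1) = n - 1 - y := by ring
        have p1 := binomMix_pascal (a := y) (b := n - y) (by omega)
        rw [e3] at p1
        rw [e1, p1, pow_succ _ (n + 1)]
        ring
      -- The coordinate has not changed yet, so no vertex up to `b` is in the slice and the problem
      -- moves on to the tail.
      · have hb0 : b i = 0 := by omega
        have hempty : (Finset.univ.filter fun v : Cube d => v i = 1 ∧ v < b) = ∅ := by
          refine Finset.filter_eq_empty_iff.2 fun v _ h => hb ?_
          exact le_antisymm (Fin.le_last _) (h.1 ▸ h.2.le i)
        rw [hempty, Finset.sum_empty, if_neg hb, zero_add, zero_add]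
        simp only [weight_cons_of_lt hab x y n _ hy]
        rw [← Finset.mul_sum]
        rcases lt_or_ge ((n : ℤ) - 1 - y) 0 with h | h
        · rw [binomMix_of_neg_right h]; ring
        · rw [ih h hb0 ht, mul_zero]
          obtain ⟨p, hp, hpi⟩ := hi
          rcases List.mem_cons.1 hp with rfl | hp
          · exact absurd hpi hb
          · exact ⟨p, hp, hpi⟩
    · refine Finset.sum_eq_zero fun v _ => ?_
      rw [insertVertex]
      split_ifs with h1 h2
      · exact weight_cons_of_not_lt hab _ _ _
      · exact weight_cons_of_not_lt (fun h => hab (h.trans h2)) _ _ _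
      · exact weight_cons_of_not_lt hab _ _ _

theorem chainWeight_cons (b : Cube d) (n : ℕ) (t : List (Cube d × ℕ)) :
    chainWeight ((b, n) :: t) = (-1) ^ (n + 1) * binomMix (length b) (n - 1 - length b) *
      weight b (n - 1 - length b) t := rfl

theorem chainWeight_cons_insertVertex {b v : Cube d} (h : ¬ b < v) (n : ℕ)
    (t : List (Cube d × ℕ)) : chainWeight ((b, n) :: insertVertex v t) = 0 := by
  rw [chainWeight_cons, weight_insertVertex_of_not_lt h, mul_zero]

/-- A simple first vertex sends no chips to the left, so it must have length zero. -/
theorem chainWeight_cons_cons {b v : Cube d} (h : v < b) (n : ℕ) (t : List (Cube d × ℕ)) :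
    chainWeight ((v, 1) :: (b, n) :: t) = if v = 0 then
      (-1) ^ (n + 1) * binomMix (length b - 1) (n - length b) * weight b (n - length b) t
      else 0 := by
  have hlen := length_strictMono h
  rw [chainWeight_cons, show (((1 : ℕ) : ℤ) - 1 - length v) = -(length v : ℤ) by push_cast; ring,
    binomMix_neg_self]
  by_cases hv : v = 0
  · subst hv
    rw [length_zero] at hlen ⊢
    rw [if_pos (by simp), if_pos rfl, Nat.cast_zero, neg_zero,
      weight_cons_of_lt h 0 (length b - 1) n t (by rw [length_zero]; push_cast; ring),
      binomMix_zero_left (by omega), show (n : ℤ) - 1 - (length b - 1) = n - length b by ring]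
    ring
  · rw [if_neg hv, if_neg]
    · ring
    · intro h0
      exact hv (eq_of_le_of_length_le (zero_le_cube v) (by rw [length_zero]; omega)).symm

/-- The vertex `0`, the vertex `b` with raised multiplicity and the vertices above `b` contribute,
up to a common factor, `binomMix (length b - 1) (n - length b)`, `-binomMix (length b) (n - length
b)` and `binomMix (length b) (n - 1 - length b)`, which cancel by Pascal's rule. -/
theorem sum_chainWeight_insertVertex (b : Cube d) (n : ℕ) (t : List (Cube d × ℕ))
    (hL : ∀ p ∈ (b, n) :: t, 1 ≤ p.2) :
    ∑ v, chainWeight (insertVertex v ((b, n) :: t)) = 0 := by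
  have hn : 1 ≤ n := hL (b, n) (by simp)
  have key := sum_insertVertex_cons chainWeight (fun _ => True) b n t
    fun v hv => chainWeight_cons_insertVertex hv n t
  simp only [Finset.filter_true, true_and, if_true] at key
  have gap : ∑ v with v < b, chainWeight ((v, 1) :: (b, n) :: t) =
      (-1) ^ (n + 1) * binomMix (length b - 1) (n - length b) * weight b (n - length b) t := by
    rw [Finset.sum_congr rfl fun v hv => chainWeight_cons_cons (Finset.mem_filter.1 hv).2 n t,
      Finset.sum_ite_eq']
    split_ifs with h
    · rfl
    · have hb : b = 0 := by
        by_contra hb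
        exact h (by simpa using lt_of_le_of_ne (zero_le_cube b) (Ne.symm hb))
      subst hb
      rw [length_zero, binomMix_of_neg_left (by simp)]
      ring
  have above : ∑ v, chainWeight ((b, n) :: insertVertex v t) =
      (-1) ^ (n + 1) * binomMix (length b) (n - 1 - length b) * weight b (n - length b) t := by
    simp only [chainWeight_cons]
    rw [← Finset.mul_sum]
    rcases lt_or_ge ((n : ℤ) - 1 - length b) 0 with h | h
    · rw [binomMix_of_neg_right h]; ring
    · rw [sum_weight_insertVertex h _ fun p hp => hL p (by simp [hp])]
      ring_nf
  rw [key, gap, above, chainWeight_cons]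
  have e1 : (((n + 1 : ℕ) : ℤ) - 1 - length b) = n - length b := by push_cast; ring
  have e3 : ((n : ℤ) - length b - 1) = n - 1 - length b := by ring
  have p1 := binomMix_pascal (a := length b) (b := n - length b) (by omega)
  rw [e3] at p1
  rw [e1, p1, pow_succ _ (n + 1)]
  ring

/-- No vertex up to `b` lies in the slice, so the factor of `b` can be taken out and the statement
for `weight` applies to the tail. -/
theorem sum_chainWeight_insertVertex_slice (b : Cube d) (n : ℕ) (t : List (Cube d × ℕ))
    (hL : ∀ p ∈ (b, n) :: t, 1 ≤ p.2) (i : Fin d) (hb : b i = 0) (hi : ∃ p ∈ t, p.1 i = 1) :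
    ∑ v with v i = 1, chainWeight (insertVertex v ((b, n) :: t)) = 0 := by
  have hempty : (Finset.univ.filter fun v : Cube d => v i = 1 ∧ v < b) = ∅ := by
    refine Finset.filter_eq_empty_iff.2 fun v _ h => ?_
    have := h.2.le i
    rw [h.1, hb] at this
    exact absurd this (Fin.not_le.2 Fin.zero_lt_one)
  rw [sum_insertVertex_cons chainWeight (fun v => v i = 1) b n t
    fun v hv => chainWeight_cons_insertVertex hv n t, hempty, Finset.sum_empty,
    if_neg (by simp [hb]), zero_add, zero_add]
  simp only [chainWeight_cons]
  rw [← Finset.mul_sum]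
  rcases lt_or_ge ((n : ℤ) - 1 - length b) 0 with h | h
  · rw [binomMix_of_neg_right h]; ring
  · rw [sum_weight_insertVertex_slice h i hb t (fun p hp => hL p (by simp [hp])) hi, mul_zero]

end Weight

/-! ### Chains as sorted lists and as exponent vectors -/

section ChainList

variable {d : ℕ}

/-- A list of vertices with positive multiplicities which is strictly increasing. -/
def IsChainList (L : List (Cube d × ℕ)) : Prop :=
  L.Pairwise (fun p q => p.1 < q.1) ∧ ∀ p ∈ L, 1 ≤ p.2

/-- The exponent vector of a list of vertices with multiplicities. -/
noncomputable def exponents (L : List (Cube d × ℕ)) : Cube d →₀ ℕ :=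
  (L.map fun p => Finsupp.single p.1 p.2).sum

theorem exponents_cons (p : Cube d × ℕ) (t : List (Cube d × ℕ)) :
    exponents (p :: t) = Finsupp.single p.1 p.2 + exponents t := by
  simp [exponents]

theorem IsChainList.tail {p : Cube d × ℕ} {t : List (Cube d × ℕ)} (h : IsChainList (p :: t)) :
    IsChainList t :=
  ⟨(List.pairwise_cons.1 h.1).2, fun q hq => h.2 q (by simp [hq])⟩

theorem mem_support_exponents {L : List (Cube d × ℕ)} (hL : ∀ p ∈ L, 1 ≤ p.2) {v : Cube d} :
    v ∈ (exponents L).support ↔ ∃ p ∈ L, p.1 = v := by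
  induction L with
  | nil => simp [exponents]
  | cons p t ih =>
    have ih := ih fun q hq => hL q (by simp [hq])
    have hp := hL p (by simp)
    rw [Finsupp.mem_support_iff] at ih ⊢
    rw [exponents_cons, Finsupp.add_apply]
    by_cases h : p.1 = v
    · subst h
      simp only [Finsupp.single_eq_same]
      constructor
      · intro _; exact ⟨p, by simp, rfl⟩
      · intro _; omega
    · rw [Finsupp.single_eq_of_ne (Ne.symm h), zero_add, ih]
      simp [h]

theorem IsChainList.comparable {L : List (Cube d × ℕ)} (hL : IsChainList L) {p q : Cube d × ℕ}
    (hp : p ∈ L) (hq : q ∈ L) : p.1 ≤ q.1 ∨ q.1 ≤ p.1 := by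
  induction L with
  | nil => simp at hp
  | cons r t ih =>
    have hr := (List.pairwise_cons.1 hL.1).1
    rcases List.mem_cons.1 hp with rfl | hp' <;> rcases List.mem_cons.1 hq with rfl | hq'
    · exact Or.inl le_rfl
    · exact Or.inl (hr _ hq').le
    · exact Or.inr (hr _ hp').le
    · exact ih hL.tail hp' hq'

theorem IsChainList.isChain_support {L : List (Cube d × ℕ)} (hL : IsChainList L) :
    IsChain (· ≤ ·) ((exponents L).support : Set (Cube d)) := by
  intro v hv w hw _
  obtain ⟨p, hp, rfl⟩ := (mem_support_exponents hL.2).1 hv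
  obtain ⟨q, hq, rfl⟩ := (mem_support_exponents hL.2).1 hw
  exact hL.comparable hp hq

/-- The head of a chain list is recovered as the least vertex of the support together with its
exponent. -/
theorem exponents_injective {L L' : List (Cube d × ℕ)} (hL : IsChainList L) (hL' : IsChainList L')
    (h : exponents L = exponents L') : L = L' := by
  induction L generalizing L' with
  | nil =>
    cases L' with
    | nil => rfl
    | cons q t' =>
      have : q.1 ∈ (exponents (q :: t')).support :=
        (mem_support_exponents hL'.2).2 ⟨q, by simp, rfl⟩
      rw [← h] at this
      simp [exponents] at this
  | cons p t ih =>
    cases L' with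
    | nil =>
      have : p.1 ∈ (exponents (p :: t)).support :=
        (mem_support_exponents hL.2).2 ⟨p, by simp, rfl⟩
      rw [h] at this
      simp [exponents] at this
    | cons q t' =>
      have hmin : ∀ {r : Cube d × ℕ} {s : List (Cube d × ℕ)} {v : Cube d}, IsChainList (r :: s) →
          v ∈ (exponents (r :: s)).support → r.1 ≤ v := by
        intro r s v hrs hv
        obtain ⟨w, hw, rfl⟩ := (mem_support_exponents hrs.2).1 hv
        rcases List.mem_cons.1 hw with rfl | hw
        · exact le_rfl
        · exact ((List.pairwise_cons.1 hrs.1).1 _ hw).le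
      have hzero : ∀ {r : Cube d × ℕ} {s : List (Cube d × ℕ)}, IsChainList (r :: s) →
          exponents (r :: s) r.1 = r.2 := by
        intro r s hrs
        rw [exponents_cons, Finsupp.add_apply, Finsupp.single_eq_same]
        have : r.1 ∉ (exponents s).support := fun hr => by
          obtain ⟨w, hw, hwr⟩ := (mem_support_exponents hrs.tail.2).1 hr
          exact ((List.pairwise_cons.1 hrs.1).1 _ hw).ne hwr.symm
        rw [Finsupp.notMem_support_iff.1 this, add_zero]
      have h1 : p.1 = q.1 := by
        refine le_antisymm (hmin hL ?_) (hmin hL' ?_)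
        · rw [h]; exact (mem_support_exponents hL'.2).2 ⟨q, by simp, rfl⟩
        · rw [← h]; exact (mem_support_exponents hL.2).2 ⟨p, by simp, rfl⟩
      have h2 : p.2 = q.2 := by rw [← hzero hL, ← hzero hL', h, h1]
      have hpq : p = q := Prod.ext h1 h2
      subst hpq
      rw [exponents_cons, exponents_cons, add_right_inj] at h
      rw [ih hL.tail hL'.tail h]

theorem exponents_insertVertex (v : Cube d) (L : List (Cube d × ℕ)) :
    exponents (insertVertex v L) = exponents L + Finsupp.single v 1 := by
  induction L with
  | nil => simp [insertVertex, exponents]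
  | cons p t ih =>
    rw [insertVertex]
    split_ifs with h1 h2
    · rw [exponents_cons, exponents_cons, h1, Finsupp.single_add]
      abel
    · rw [exponents_cons, add_comm]
    · rw [exponents_cons, exponents_cons, ih, add_assoc]

theorem mem_insertVertex {v : Cube d} {L : List (Cube d × ℕ)} {p : Cube d × ℕ}
    (h : p ∈ insertVertex v L) : p.1 = v ∨ ∃ q ∈ L, q.1 = p.1 := by
  induction L with
  | nil => simp only [insertVertex, List.mem_singleton] at h; simp [h]
  | cons q t ih =>
    rw [insertVertex] at h
    split_ifs at h with h1 h2
    · rcases List.mem_cons.1 h with rfl | h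
      · exact Or.inl h1.symm
      · exact Or.inr ⟨p, by simp [h], rfl⟩
    · rcases List.mem_cons.1 h with rfl | h
      · exact Or.inl rfl
      · exact Or.inr ⟨p, h, rfl⟩
    · rcases List.mem_cons.1 h with rfl | h
      · exact Or.inr ⟨p, by simp, rfl⟩
      · rcases ih h with h | ⟨r, hr, hrp⟩
        · exact Or.inl h
        · exact Or.inr ⟨r, by simp [hr], hrp⟩

theorem one_le_of_mem_insertVertex {v : Cube d} {L : List (Cube d × ℕ)} (hL : ∀ p ∈ L, 1 ≤ p.2)
    {p : Cube d × ℕ} (h : p ∈ insertVertex v L) : 1 ≤ p.2 := by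
  induction L with
  | nil => simp only [insertVertex, List.mem_singleton] at h; simp [h]
  | cons q t ih =>
    rw [insertVertex] at h
    split_ifs at h with h1 h2
    · rcases List.mem_cons.1 h with rfl | h
      · simp
      · exact hL p (by simp [h])
    · rcases List.mem_cons.1 h with rfl | h
      · simp
      · exact hL p h
    · rcases List.mem_cons.1 h with rfl | h
      · exact hL p (by simp)
      · exact ih (fun r hr => hL r (by simp [hr])) h

theorem IsChainList.insertVertex {v : Cube d} {L : List (Cube d × ℕ)} (hL : IsChainList L)
    (hv : ∀ p ∈ L, v ≤ p.1 ∨ p.1 ≤ v) : IsChainList (insertVertex v L) := by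
  refine ⟨?_, fun p hp => one_le_of_mem_insertVertex hL.2 hp⟩
  induction L with
  | nil => simp [GrossSchoen.insertVertex]
  | cons q t ih =>
    have hq := List.pairwise_cons.1 hL.1
    rw [GrossSchoen.insertVertex]
    split_ifs with h1 h2
    · exact List.pairwise_cons.2 ⟨hq.1, hq.2⟩
    · refine List.pairwise_cons.2 ⟨fun r hr => ?_, hL.1⟩
      rcases List.mem_cons.1 hr with rfl | hr
      · exact h2
      · exact h2.trans (hq.1 r hr)
    · refine List.pairwise_cons.2 ⟨fun r hr => ?_, ih hL.tail fun p hp => hv p (by simp [hp])⟩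
      rcases mem_insertVertex hr with h | ⟨s, hs, hsr⟩
      · rw [h]
        rcases hv q (by simp) with h' | h'
        · exact absurd (lt_of_le_of_ne h' h1) h2
        · exact lt_of_le_of_ne h' (Ne.symm h1)
      · rw [← hsr]; exact hq.1 s hs

/-- Insertion sort: the multiset of vertices is built up one vertex at a time by `insertVertex`. -/
theorem exists_isChainList (s : Cube d →₀ ℕ) (hs : IsChain (· ≤ ·) (s.support : Set (Cube d))) :
    ∃ L, IsChainList L ∧ exponents L = s := by
  obtain ⟨m, rfl⟩ : ∃ m : Multiset (Cube d), Multiset.toFinsupp m = s :=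
    ⟨Finsupp.toMultiset s, by simp⟩
  induction m using Multiset.induction_on with
  | empty => exact ⟨[], ⟨by simp, by simp⟩, by simp [exponents]⟩
  | cons v m ih =>
    rw [Multiset.toFinsupp_support] at hs
    obtain ⟨L, hL, hLm⟩ := ih (hs.mono (by
      rw [Multiset.toFinsupp_support]
      intro w hw
      simp only [Finset.mem_coe, Multiset.mem_toFinset] at hw ⊢
      exact Multiset.mem_cons_of_mem hw))
    refine ⟨insertVertex v L, hL.insertVertex fun p hp => ?_, ?_⟩
    · have : p.1 ∈ (exponents L).support := (mem_support_exponents hL.2).2 ⟨p, hp, rfl⟩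
      rw [hLm, Multiset.toFinsupp_support, Multiset.mem_toFinset] at this
      exact hs.total (by simp) (by simp [this])
    · rw [exponents_insertVertex, hLm, ← Multiset.singleton_add, map_add, add_comm,
        Multiset.toFinsupp_singleton]

/-- The weight itself tests whether a list is strictly increasing. Hence `insertVertex` may be
applied to a vertex incomparable with the chain, where the result is not a chain but has weight
zero. -/
theorem pairwise_of_weight_ne_zero {a : Cube d} {x : ℤ} {L : List (Cube d × ℕ)}
    (h : weight a x L ≠ 0) : (∀ p ∈ L, a < p.1) ∧ L.Pairwise (fun p q => p.1 < q.1) := by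
  induction L generalizing a x with
  | nil => simp
  | cons p t ih =>
    obtain ⟨b, n⟩ := p
    by_cases hab : a < b
    · rw [weight_cons_of_lt hab _ _ _ _ rfl] at h
      have := ih (right_ne_zero_of_mul h)
      refine ⟨fun q hq => ?_, List.pairwise_cons.2 this⟩
      rcases List.mem_cons.1 hq with rfl | hq
      · exact hab
      · exact hab.trans (this.1 q hq)
    · exact absurd (weight_cons_of_not_lt hab _ _ _) h

theorem pairwise_of_chainWeight_ne_zero {L : List (Cube d × ℕ)} (h : chainWeight L ≠ 0) :
    L.Pairwise (fun p q => p.1 < q.1) := by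
  cases L with
  | nil => simp
  | cons p t =>
    obtain ⟨b, n⟩ := p
    rw [chainWeight_cons] at h
    exact List.pairwise_cons.2 (pairwise_of_weight_ne_zero (right_ne_zero_of_mul h))

open scoped Classical in
/-- The value of the degree map on the monomial with exponents `s`. -/
noncomputable def chainCoeff (s : Cube d →₀ ℕ) : ℤ :=
  if h : ∃ L, IsChainList L ∧ exponents L = s then chainWeight h.choose else 0

theorem chainCoeff_exponents {L : List (Cube d × ℕ)} (hL : IsChainList L) :
    chainCoeff (exponents L) = chainWeight L := by
  have h : ∃ L', IsChainList L' ∧ exponents L' = exponents L := ⟨L, hL, rfl⟩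
  rw [chainCoeff, dif_pos h, exponents_injective h.choose_spec.1 hL h.choose_spec.2]

theorem chainCoeff_of_not_isChain {s : Cube d →₀ ℕ}
    (hs : ¬ IsChain (· ≤ ·) (s.support : Set (Cube d))) : chainCoeff s = 0 := by
  rw [chainCoeff, dif_neg]
  rintro ⟨L, hL, rfl⟩
  exact hs hL.isChain_support

/-- This passes from exponent vectors to lists. If `v` is not comparable with the whole chain, both
sides are zero. -/
theorem chainCoeff_add_single {L : List (Cube d × ℕ)} (hL : IsChainList L) (v : Cube d) :
    chainCoeff (exponents L + Finsupp.single v 1) = chainWeight (insertVertex v L) := by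
  rw [← exponents_insertVertex]
  by_cases h : IsChainList (insertVertex v L)
  · exact chainCoeff_exponents h
  · have h0 : chainWeight (insertVertex v L) = 0 := by
      by_contra h0
      exact h ⟨pairwise_of_chainWeight_ne_zero h0, fun p hp => one_le_of_mem_insertVertex hL.2 hp⟩
    rw [h0]
    refine chainCoeff_of_not_isChain fun hc => h (hL.insertVertex fun p hp => ?_)
    refine hc.total ?_ ?_
    · rw [Finset.mem_coe, Finsupp.mem_support_iff, exponents_insertVertex]
      simp
    · have : p.1 ∈ (exponents L).support := (mem_support_exponents hL.2).2 ⟨p, hp, rfl⟩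
      rw [Finsupp.mem_support_iff] at this
      rw [Finset.mem_coe, Finsupp.mem_support_iff, exponents_insertVertex, Finsupp.add_apply]
      omega

theorem chainCoeff_add_single_of_not_isChain {m : Cube d →₀ ℕ}
    (hm : ¬ IsChain (· ≤ ·) (m.support : Set (Cube d))) (v : Cube d) :
    chainCoeff (m + Finsupp.single v 1) = 0 := by
  refine chainCoeff_of_not_isChain fun h => hm (h.mono ?_)
  intro w hw
  rw [Finset.mem_coe, Finsupp.mem_support_iff] at hw ⊢
  rw [Finsupp.add_apply]
  omega

theorem sum_chainCoeff_total {m : Cube d →₀ ℕ} (hm : m ≠ 0) :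
    ∑ v, chainCoeff (m + Finsupp.single v 1) = 0 := by
  by_cases hc : IsChain (· ≤ ·) (m.support : Set (Cube d))
  · obtain ⟨L, hL, rfl⟩ := exists_isChainList m hc
    simp only [chainCoeff_add_single hL]
    cases L with
    | nil => exact absurd (by simp [exponents]) hm
    | cons p t => exact sum_chainWeight_insertVertex p.1 p.2 t hL.2
  · exact Finset.sum_eq_zero fun v _ => chainCoeff_add_single_of_not_isChain hc v

theorem sum_chainCoeff_slice_one {m : Cube d →₀ ℕ} {a b : Cube d} (ha : m a ≠ 0) (hb : m b ≠ 0)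
    (i : Fin d) (hai : a i = 0) (hbi : b i = 1) :
    ∑ v with v i = 1, chainCoeff (m + Finsupp.single v 1) = 0 := by
  by_cases hc : IsChain (· ≤ ·) (m.support : Set (Cube d))
  · obtain ⟨L, hL, rfl⟩ := exists_isChainList m hc
    simp only [chainCoeff_add_single hL]
    obtain ⟨p, hp, rfl⟩ := (mem_support_exponents hL.2).1 (Finsupp.mem_support_iff.2 ha)
    obtain ⟨q, hq, rfl⟩ := (mem_support_exponents hL.2).1 (Finsupp.mem_support_iff.2 hb)
    cases L with
    | nil => simp at hp
    | cons r t =>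
      have hr : r.1 i = 0 := by
        rcases List.mem_cons.1 hp with rfl | hp
        · exact hai
        · have := ((List.pairwise_cons.1 hL.1).1 p hp).le i
          rw [hai] at this
          exact le_antisymm this (Fin.zero_le _)
      refine sum_chainWeight_insertVertex_slice r.1 r.2 t hL.2 i hr ⟨q, ?_, hbi⟩
      rcases List.mem_cons.1 hq with rfl | hq
      · rw [hr] at hbi
        exact absurd hbi (Fin.zero_ne_one)
      · exact hq
  · exact Finset.sum_eq_zero fun v _ => chainCoeff_add_single_of_not_isChain hc v

/-- The slice where the coordinate is zero is the complement of the slice where it is one, and the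
sum over all vertices is already known to vanish. -/
theorem sum_chainCoeff_slice {m : Cube d →₀ ℕ} {a b : Cube d} (ha : m a ≠ 0) (hb : m b ≠ 0)
    (i : Fin d) (hab : a i ≠ b i) :
    ∑ v with v i = a i, chainCoeff (m + Finsupp.single v 1) = 0 := by
  have htwo : ∀ z : Fin 2, z = 0 ∨ z = 1 := by decide
  rcases htwo (a i) with h0 | h1
  · have hb1 : b i = 1 := (htwo (b i)).resolve_left fun h => hab (h0.trans h.symm)
    have h := sum_chainCoeff_slice_one ha hb i h0 hb1
    have htot := sum_chainCoeff_total (m := m) (by rintro rfl; simp at ha)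
    rw [← Finset.sum_filter_add_sum_filter_not Finset.univ (fun v : Cube d => v i = 1), h,
      zero_add] at htot
    rw [← htot, h0]
    refine Finset.sum_congr (Finset.filter_congr fun v _ => ?_) fun _ _ => rfl
    rcases htwo (v i) with h | h <;> simp [h]
  · have hb0 : b i = 0 := (htwo (b i)).resolve_right fun h => hab (h1.trans h.symm)
    rw [h1]
    exact sum_chainCoeff_slice_one hb ha i hb0 h1

end ChainList

/-! ### The functional descends to the Chow ring -/

section Functional

open MvPolynomial

variable {d : ℕ}

/-- A coordinate with only the values `0` and `1` increases at most once along a monotone sequence,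
so the disjointness condition is automatic in the cube. -/
theorem isSimplex_of_monotone {k : ℕ} {σ : Fin (k + 1) → Cube d} (hσ : Monotone σ) :
    IsSimplex (cubeGraphs d) σ := by
  refine ⟨fun j => ⟨hσ j.castSucc_lt_succ.le, fun i hi => hi.ne⟩, ?_⟩
  have key : ∀ j j' : Fin k, j < j' → Disjoint
      (increase (σ j.castSucc) (σ j.succ)) (increase (σ j'.castSucc) (σ j'.succ)) := by
    intro j j' hjj
    rw [Set.disjoint_left]
    intro i hi hi'
    simp only [increase, Set.mem_ofPred_eq] at hi hi'
    have h : j.succ ≤ j'.castSucc := by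
      rw [Fin.le_def]; simpa using hjj
    have h1 := hi.trans_le (hσ h i)
    have h2 := h1.trans hi'
    omega
  intro j j' hjj
  rcases lt_or_gt_of_ne hjj with h | h
  · exact key j j' h
  · exact (key j' j h).symm

/-- Pairwise comparable vertices form a simplex of the cube. -/
theorem formsSimplex_of_comparable {k : ℕ} (w : Fin (k + 1) → Cube d)
    (hw : ∀ i j, w i ≤ w j ∨ w j ≤ w i) : FormsSimplex (cubeGraphs d) w := by
  -- Sorting by length suffices, since comparable vertices of equal length coincide.
  refine ⟨Tuple.sort (length ∘ w), isSimplex_of_monotone fun i j hij => ?_⟩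
  have hlen := Tuple.monotone_sort (length ∘ w) hij
  rcases hw (Tuple.sort (length ∘ w) i) (Tuple.sort (length ∘ w) j) with h | h
  · exact h
  · exact (eq_of_le_of_length_le h hlen).ge

/-- The degree map on polynomials. -/
noncomputable def degFunctional (d : ℕ) : MvPolynomial (Cube d) ℤ →ₗ[ℤ] ℤ :=
  (basisMonomials (Cube d) ℤ).constr ℤ chainCoeff

theorem degFunctional_monomial (s : Cube d →₀ ℕ) :
    degFunctional d (monomial s 1) = chainCoeff s := by
  have := (basisMonomials (Cube d) ℤ).constr_basis ℤ chainCoeff s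
  rwa [coe_basisMonomials] at this

theorem prod_X_eq_monomial {ι : Type*} (t : Finset ι) (w : ι → Cube d) :
    ∏ j ∈ t, (X (w j) : MvPolynomial (Cube d) ℤ) =
      monomial (∑ j ∈ t, Finsupp.single (w j) 1) 1 := by
  rw [monomial_sum_one]; rfl

theorem degFunctional_monomial_mul_generator (s : Cube d →₀ ℕ) {g : MvPolynomial (Cube d) ℤ}
    (hg : RatGenerator (cubeGraphs d) g) : degFunctional d (monomial s 1 * g) = 0 := by
  cases hg with
  | nonSimplex w hw =>
    rw [prod_X_eq_monomial, monomial_mul, one_mul, degFunctional_monomial]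
    refine chainCoeff_of_not_isChain fun hc => hw (formsSimplex_of_comparable w fun i j => ?_)
    have hmem : ∀ i, w i ∈ ((s + ∑ j, Finsupp.single (w j) 1).support : Set (Cube d)) := by
      intro i
      rw [Finset.mem_coe, Finsupp.mem_support_iff, Finsupp.add_apply, Finsupp.finsetSum_apply]
      have := Finset.single_le_sum (f := fun j => Finsupp.single (w j) 1 (w i))
        (fun j _ => Nat.zero_le _) (Finset.mem_univ i)
      simp only [Finsupp.single_eq_same] at this
      omega
    exact hc.total (hmem i) (hmem j)
  | total a =>
    have h : (monomial s (1 : ℤ)) * (X a * ∑ b, X b) =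
        ∑ v, monomial (s + Finsupp.single a 1 + Finsupp.single v 1) 1 := by
      rw [← mul_assoc, X, monomial_mul, Finset.mul_sum]
      refine Finset.sum_congr rfl fun v _ => ?_
      rw [X, monomial_mul]; simp
    rw [h, map_sum]
    simp only [degFunctional_monomial]
    exact sum_chainCoeff_total fun h => by simpa using DFunLike.congr_fun h a
  | slice a b i hab =>
    have h : (monomial s (1 : ℤ)) * (X a * X b * ∑ c with c i = a i, X c) =
        ∑ v with v i = a i,
          monomial (s + Finsupp.single a 1 + Finsupp.single b 1 + Finsupp.single v 1) 1 := by
      rw [← mul_assoc, ← mul_assoc, X, monomial_mul, X, monomial_mul, Finset.mul_sum]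
      refine Finset.sum_congr rfl fun v _ => ?_
      rw [X, monomial_mul]; simp
    rw [h, map_sum]
    simp only [degFunctional_monomial]
    exact sum_chainCoeff_slice (a := a) (b := b) (by simp) (by simp) i hab

theorem degFunctional_eq_zero {p : MvPolynomial (Cube d) ℤ} (hp : p ∈ ratIdeal (cubeGraphs d)) :
    degFunctional d p = 0 := by
  -- The functional is only `ℤ`-linear, so the induction over the ideal has to carry all multiples
  -- of `p`.
  have key : ∀ q, degFunctional d (q * p) = 0 := by
    refine Submodule.span_induction (p := fun p _ => ∀ q, degFunctional d (q * p) = 0)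
      ?_ ?_ ?_ ?_ hp
    · intro g hg q
      induction q using MvPolynomial.induction_on' with
      | monomial s c =>
        rw [show monomial s c = c • monomial s (1 : ℤ) by simp [smul_monomial],
          smul_mul_assoc, map_smul,
          degFunctional_monomial_mul_generator s hg, smul_zero]
      | add q r hq hr => rw [add_mul, map_add, hq, hr, add_zero]
    · intro q; simp
    · intro x y _ _ hx hy q
      rw [mul_add, map_add, hx, hy, add_zero]
    · intro a x _ hx q
      rw [smul_eq_mul, ← mul_assoc]
      exact hx _
  simpa using key 1

/-- The degree map on the Chow ring of the cube. -/
noncomputable def chowDegree (d : ℕ) : ChowRing (cubeGraphs d) →ₗ[ℤ] ℤ :=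
  ((ratIdeal (cubeGraphs d)).restrictScalars ℤ).liftQ (degFunctional d)
    fun _ hp => degFunctional_eq_zero hp

theorem chowDegree_mk (p : MvPolynomial (Cube d) ℤ) :
    chowDegree d (Ideal.Quotient.mk (ratIdeal (cubeGraphs d)) p) = degFunctional d p := rfl

end Functional

/-! ### The top graded piece is generated by one maximal chain -/

section Generation

open MvPolynomial

variable {d : ℕ}

/-- The class of the monomial with exponents `s`. -/
noncomputable def monoClass (s : Cube d →₀ ℕ) : ChowRing (cubeGraphs d) :=
  Ideal.Quotient.mk (ratIdeal (cubeGraphs d)) (monomial s 1)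

theorem chowDegree_monoClass (s : Cube d →₀ ℕ) : chowDegree d (monoClass s) = chainCoeff s := by
  rw [monoClass, chowDegree_mk, degFunctional_monomial]

theorem comparable_of_formsSimplex {v w : Cube d} (h : FormsSimplex (cubeGraphs d) ![v, w]) :
    v ≤ w ∨ w ≤ v := by
  obtain ⟨π, hπ⟩ := h
  have h0 := (hπ.edge 0).1
  have htwo : ∀ z : Fin 2, z = 0 ∨ z = 1 := by decide
  have hne : π 0 ≠ π 1 := fun h => Fin.zero_ne_one (π.injective h)
  simp only [Function.comp_apply, Fin.castSucc_zero, Fin.succ_zero_eq_one] at h0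
  rcases htwo (π 0) with h | h <;> rcases htwo (π 1) with h' | h'
  · exact absurd (h.trans h'.symm) hne
  · rw [h, h'] at h0; exact Or.inl h0
  · rw [h, h'] at h0; exact Or.inr h0
  · exact absurd (h.trans h'.symm) hne

/-- Such a monomial is divisible by `C_v C_w` for two incomparable vertices, which is a generator of
the ideal. -/
theorem monoClass_of_not_isChain {s : Cube d →₀ ℕ}
    (hs : ¬ IsChain (· ≤ ·) (s.support : Set (Cube d))) : monoClass s = 0 := by
  simp only [IsChain, Set.Pairwise, not_forall] at hs
  obtain ⟨v, hv, w, hw, hvw, hnot⟩ := hs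
  rw [Finset.mem_coe, Finsupp.mem_support_iff] at hv hw
  have hgen : (∏ j, X (![v, w] j) : MvPolynomial (Cube d) ℤ) ∈ ratIdeal (cubeGraphs d) :=
    Ideal.subset_span (RatGenerator.nonSimplex _ fun h => hnot (comparable_of_formsSimplex h))
  have hle : Finsupp.single v 1 + Finsupp.single w 1 ≤ s := by
    intro x
    rw [Finsupp.add_apply]
    by_cases h1 : x = v
    · subst h1
      rw [Finsupp.single_eq_same, Finsupp.single_eq_of_ne hvw]
      omega
    · rw [Finsupp.single_eq_of_ne h1]
      by_cases h2 : x = w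
      · subst h2
        rw [Finsupp.single_eq_same]
        omega
      · rw [Finsupp.single_eq_of_ne h2]
        omega
  have hs : monomial s (1 : ℤ) =
      monomial (s - (Finsupp.single v 1 + Finsupp.single w 1)) 1 * ∏ j, X (![v, w] j) := by
    rw [Fin.prod_univ_two]
    simp only [Matrix.cons_val_zero, Matrix.cons_val_one, X, monomial_mul, one_mul]
    rw [tsub_add_cancel_of_le hle]
  rw [monoClass, Ideal.Quotient.eq_zero_iff_mem, hs]
  exact Ideal.mul_mem_left _ _ hgen

theorem sum_monoClass (m : Cube d →₀ ℕ) (t : Finset (Cube d)) :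
    ∑ v ∈ t, monoClass (m + Finsupp.single v 1) =
      Ideal.Quotient.mk (ratIdeal (cubeGraphs d)) (monomial m 1 * ∑ v ∈ t, X v) := by
  rw [Finset.mul_sum, map_sum]
  refine Finset.sum_congr rfl fun v _ => ?_
  rw [X, monomial_mul, one_mul, monoClass]

theorem sum_monoClass_total {m : Cube d →₀ ℕ} (hm : m ≠ 0) :
    ∑ v, monoClass (m + Finsupp.single v 1) = 0 := by
  obtain ⟨a, ha⟩ := DFunLike.ne_iff.1 hm
  have hgen : (X a * ∑ v, X v : MvPolynomial (Cube d) ℤ) ∈ ratIdeal (cubeGraphs d) :=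
    Ideal.subset_span (RatGenerator.total a)
  have hle : Finsupp.single a 1 ≤ m := by
    rw [Finsupp.single_le_iff]
    exact Nat.one_le_iff_ne_zero.2 ha
  have h : monomial m (1 : ℤ) = monomial (m - Finsupp.single a 1) 1 * X a := by
    rw [X, monomial_mul, one_mul, tsub_add_cancel_of_le hle]
  rw [sum_monoClass, Ideal.Quotient.eq_zero_iff_mem, h, mul_assoc]
  exact Ideal.mul_mem_left _ _ hgen

theorem sum_monoClass_slice {m : Cube d →₀ ℕ} {a b : Cube d} (ha : m a ≠ 0) (hb : m b ≠ 0)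
    {i : Fin d} (hai : a i = 0) (hbi : b i = 1) :
    ∑ v with v i = 0, monoClass (m + Finsupp.single v 1) = 0 := by
  have hne : a i ≠ b i := by rw [hai, hbi]; exact Fin.zero_ne_one
  have hgen : (X a * X b * ∑ v with v i = a i, X v : MvPolynomial (Cube d) ℤ) ∈
      ratIdeal (cubeGraphs d) := Ideal.subset_span (RatGenerator.slice a b i hne)
  have hab : a ≠ b := by rintro rfl; exact hne rfl
  have hle : Finsupp.single a 1 + Finsupp.single b 1 ≤ m := by
    intro x
    rw [Finsupp.add_apply]
    by_cases h1 : x = a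
    · subst h1
      rw [Finsupp.single_eq_same, Finsupp.single_eq_of_ne hab]
      omega
    · rw [Finsupp.single_eq_of_ne h1]
      by_cases h2 : x = b
      · subst h2
        rw [Finsupp.single_eq_same]
        omega
      · rw [Finsupp.single_eq_of_ne h2]
        omega
  have h : monomial m (1 : ℤ) =
      monomial (m - (Finsupp.single a 1 + Finsupp.single b 1)) 1 * (X a * X b) := by
    simp only [X, monomial_mul, one_mul]
    rw [tsub_add_cancel_of_le hle]
  rw [sum_monoClass, Ideal.Quotient.eq_zero_iff_mem, h, mul_assoc]
  rw [hai] at hgen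
  exact Ideal.mul_mem_left _ _ hgen

/-- The `j`-th vertex of the maximal chain along which the coordinates change in the order `q`. -/
def permChain (q : Equiv.Perm (Fin d)) (j : ℕ) : Cube d :=
  fun i => if (q.symm i : ℕ) < j then 1 else 0

theorem permChain_eq_one {q : Equiv.Perm (Fin d)} {j : ℕ} {i : Fin d} :
    permChain q j i = 1 ↔ (q.symm i : ℕ) < j := by
  simp [permChain]

theorem permChain_eq_zero {q : Equiv.Perm (Fin d)} {j : ℕ} {i : Fin d} :
    permChain q j i = 0 ↔ j ≤ (q.symm i : ℕ) := by
  simp [permChain]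

/-- Each of the `d` steps turns some coordinate `q j` from zero to one, no coordinate is turned
twice, and hence `q` is a permutation. -/
theorem exists_permChain {σ : Fin (d + 1) → Cube d} (hσ : StrictMono σ) :
    ∃ q : Equiv.Perm (Fin d), ∀ j : Fin (d + 1), σ j = permChain q j := by
  have htwo : ∀ z : Fin 2, z = 0 ∨ z = 1 := by decide
  have h : ∀ j : Fin d, ∃ i, σ j.castSucc i = 0 ∧ σ j.succ i = 1 := by
    intro j
    obtain ⟨i, hi⟩ := (Pi.lt_def.1 (hσ j.castSucc_lt_succ)).2
    refine ⟨i, ?_⟩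
    rcases htwo (σ j.castSucc i) with h | h <;> rcases htwo (σ j.succ i) with h' | h'
    all_goals first | exact ⟨h, h'⟩ | (rw [h, h'] at hi; exact absurd hi (by decide))
  choose q hq using h
  have hq1 : ∀ (j : Fin d) (m : Fin (d + 1)), j.succ ≤ m → σ m (q j) = 1 := by
    intro j m hjm
    have := hσ.monotone hjm (q j)
    rw [(hq j).2] at this
    exact le_antisymm (Fin.le_last _) this
  have hq0 : ∀ (j : Fin d) (m : Fin (d + 1)), m ≤ j.castSucc → σ m (q j) = 0 := by
    intro j m hjm
    have := hσ.monotone hjm (q j)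
    rw [(hq j).1] at this
    exact le_antisymm this (Fin.zero_le _)
  have hinj : Function.Injective q := by
    have key : ∀ j j' : Fin d, j < j' → q j ≠ q j' := by
      intro j j' hjj h
      have h1 := hq1 j j'.castSucc (by rw [Fin.le_def]; simpa using hjj)
      rw [h, (hq j').1] at h1
      exact Fin.zero_ne_one h1
    intro j j' h
    by_contra hne
    rcases lt_or_gt_of_ne hne with h' | h'
    · exact key j j' h' h
    · exact key j' j h' h.symm
  refine ⟨Equiv.ofBijective q (Finite.injective_iff_bijective.1 hinj), fun j => funext fun i => ?_⟩
  obtain ⟨m, rfl⟩ := (Finite.injective_iff_bijective.1 hinj).2 i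
  have hm : (Equiv.ofBijective q (Finite.injective_iff_bijective.1 hinj)).symm (q m) = m :=
    Equiv.ofBijective_symm_apply_apply _ _ _
  rw [permChain, hm]
  split_ifs with h
  · exact hq1 m j (by rw [Fin.le_def]; simpa using h)
  · exact hq0 m j (by rw [Fin.le_def]; simpa using h)

/-- The exponent vector of a maximal chain. -/
noncomputable def permExponents (q : Equiv.Perm (Fin d)) : Cube d →₀ ℕ :=
  ∑ j : Fin (d + 1), Finsupp.single (permChain q j) 1

/-- The two maximal chains differ only in the vertex of length `i + 1`. With `m` the common part,
the slice relations for the two exchanged coordinates are subtracted: vertices with equal values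
there cancel, and the only others comparable with all of `m` are the two middle vertices, with
opposite signs. -/
theorem monoClass_permExponents_mul_swap {n : ℕ} (q : Equiv.Perm (Fin (n + 1))) (i : Fin n) :
    monoClass (permExponents (q * Equiv.swap i.castSucc i.succ)) =
      monoClass (permExponents q) := by
  have htwo : ∀ z : Fin 2, z = 0 ∨ z = 1 := by decide
  have hsymm : ∀ x, (q * Equiv.swap i.castSucc i.succ).symm x =
      Equiv.swap i.castSucc i.succ (q.symm x) := fun x => rfl
  obtain ⟨q', hq'⟩ : ∃ q', q' = q * Equiv.swap i.castSucc i.succ := ⟨_, rfl⟩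
  rw [← hq'] at hsymm ⊢
  have hagree : ∀ j : ℕ, j ≠ i + 1 → permChain q' j = permChain q j := by
    intro j hj
    funext x
    rw [permChain, permChain, hsymm]
    have : ((Equiv.swap i.castSucc i.succ (q.symm x) : Fin (n + 1)) : ℕ) < j ↔
        (q.symm x : ℕ) < j := by
      rw [Equiv.swap_apply_def]
      split_ifs with h1 h2
      · rw [h1]; simp only [Fin.val_succ, Fin.val_castSucc]; omega
      · rw [h2]; simp only [Fin.val_succ, Fin.val_castSucc]; omega
      · rfl
    simp only [this]
  obtain ⟨J, hJ⟩ : ∃ J : Fin (n + 2), J = i.succ.castSucc := ⟨_, rfl⟩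
  have hJv : (J : ℕ) = i + 1 := by rw [hJ]; simp
  obtain ⟨m, hm⟩ : ∃ m : Cube (n + 1) →₀ ℕ,
      m = ∑ j ∈ Finset.univ.erase J, Finsupp.single (permChain q j) 1 := ⟨_, rfl⟩
  have hexp : permExponents q = m + Finsupp.single (permChain q (i + 1)) 1 := by
    rw [permExponents, hm, ← hJv, Finset.sum_erase_add _ _ (Finset.mem_univ J)]
  have hexp' : permExponents q' = m + Finsupp.single (permChain q' (i + 1)) 1 := by
    rw [permExponents, hm, ← hJv, ← Finset.sum_erase_add _ _ (Finset.mem_univ J)]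
    congr 1
    refine Finset.sum_congr rfl fun j hj => ?_
    rw [hagree]
    rw [← hJv]
    exact fun h => (Finset.mem_erase.1 hj).1 (Fin.ext h)
  have hmem : ∀ j : ℕ, j ≤ n + 1 → j ≠ i + 1 → m (permChain q j) ≠ 0 := by
    intro j hj hji
    rw [hm, Finsupp.finsetSum_apply]
    have hmem : (⟨j, by omega⟩ : Fin (n + 2)) ∈ Finset.univ.erase J :=
      Finset.mem_erase.2 ⟨fun h => hji (by rw [← hJv, ← h]), Finset.mem_univ _⟩
    have := Finset.single_le_sum
      (f := fun k : Fin (n + 2) => Finsupp.single (permChain q k) 1 (permChain q j))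
      (fun _ _ => Nat.zero_le _) hmem
    simp only [Finsupp.single_eq_same] at this
    omega
  have hlo := hmem i (by omega) (by omega)
  have hhi := hmem (i + 2) (by omega) (by omega)
  have hα := sum_monoClass_slice (i := q i.castSucc) hlo hhi
    (by simp [permChain_eq_zero]) (by simp [permChain_eq_one])
  have hβ := sum_monoClass_slice (i := q i.succ) hlo hhi
    (by simp [permChain_eq_zero]) (by simp [permChain_eq_one])
  have c1 : permChain q (i + 1) (q i.castSucc) = 1 := by simp [permChain_eq_one]
  have c2 : permChain q (i + 1) (q i.succ) = 0 := by simp [permChain_eq_zero]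
  have c1' : permChain q' (i + 1) (q i.castSucc) = 0 := by simp [permChain_eq_zero, hsymm]
  have c2' : permChain q' (i + 1) (q i.succ) = 1 := by simp [permChain_eq_one, hsymm]
  -- The neighbouring vertices of lengths `i` and `i + 2` agree outside the two exchanged
  -- coordinates, so they fix all other coordinates of a vertex between them.
  have hrest : ∀ v : Cube (n + 1), permChain q i ≤ v → v ≤ permChain q (i + 2) →
      ∀ x, x ≠ q i.castSucc → x ≠ q i.succ →
        v x = permChain q (i + 1) x ∧ v x = permChain q' (i + 1) x := by
    intro v h1 h2 x hx hx'
    have hx1 : q.symm x ≠ i.castSucc := fun h => hx (by rw [← h]; simp)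
    have hx2 : q.symm x ≠ i.succ := fun h => hx' (by rw [← h]; simp)
    have e : permChain q' (i + 1) x = permChain q (i + 1) x := by
      rw [permChain, permChain, hsymm, Equiv.swap_apply_of_ne_of_ne hx1 hx2]
    rw [e, and_self]
    have hv1 : (q.symm x : ℕ) ≠ i := fun h => hx1 (Fin.ext (by simpa using h))
    rcases lt_or_ge (q.symm x : ℕ) (i + 1) with h | h
    · have a1 := h1 x
      rw [permChain_eq_one.2 (show (q.symm x : ℕ) < i by omega)] at a1
      rw [permChain_eq_one.2 h]
      exact le_antisymm (Fin.le_last _) a1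
    · have a1 := h2 x
      have hv2 : (q.symm x : ℕ) ≠ i + 1 := fun h => hx2 (Fin.ext (by simpa using h))
      rw [permChain_eq_zero.2 (show (i : ℕ) + 2 ≤ (q.symm x : ℕ) by omega)] at a1
      rw [permChain_eq_zero.2 h]
      exact le_antisymm a1 (Fin.zero_le _)
  have key : ∀ v : Cube (n + 1),
      ((if v (q i.castSucc) = 0 then monoClass (m + Finsupp.single v 1) else 0) -
        if v (q i.succ) = 0 then monoClass (m + Finsupp.single v 1) else 0) =
      (if v = permChain q' (i + 1) then monoClass (m + Finsupp.single v 1) else 0) -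
        if v = permChain q (i + 1) then monoClass (m + Finsupp.single v 1) else 0 := by
    intro v
    by_cases hch : IsChain (· ≤ ·) ((m + Finsupp.single v 1).support : Set (Cube (n + 1)))
    swap
    · simp [monoClass_of_not_isChain hch]
    have hmemv : ∀ w, m w ≠ 0 → w ≤ v ∨ v ≤ w := by
      intro w hw
      refine hch.total ?_ ?_
      · rw [Finset.mem_coe, Finsupp.mem_support_iff, Finsupp.add_apply]; omega
      · rw [Finset.mem_coe, Finsupp.mem_support_iff, Finsupp.add_apply]; simp
    have hle1 : (∃ x, v x = 1 ∧ (x = q i.castSucc ∨ x = q i.succ)) → permChain q i ≤ v := by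
      rintro ⟨x, hx, hx'⟩
      refine (hmemv _ hlo).resolve_right fun h => ?_
      have := h x
      rw [hx, permChain_eq_zero.2] at this
      · exact absurd this (Fin.not_le.2 Fin.zero_lt_one)
      · rcases hx' with rfl | rfl <;> simp
    have hle2 : (∃ x, v x = 0 ∧ (x = q i.castSucc ∨ x = q i.succ)) →
        v ≤ permChain q (i + 2) := by
      rintro ⟨x, hx, hx'⟩
      refine (hmemv _ hhi).resolve_left fun h => ?_
      have := h x
      rw [hx, permChain_eq_one.2] at this
      · exact absurd this (Fin.not_le.2 Fin.zero_lt_one)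
      · rcases hx' with rfl | rfl <;> simp
    rcases htwo (v (q i.castSucc)) with ha | ha <;> rcases htwo (v (q i.succ)) with hb | hb
    · have n1 : v ≠ permChain q' (i + 1) := by
        rintro rfl; rw [c2'] at hb; exact absurd hb (by decide)
      have n2 : v ≠ permChain q (i + 1) := by rintro rfl; rw [c1] at ha; exact absurd ha (by decide)
      simp [ha, hb, n1, n2]
    · have n2 : v ≠ permChain q (i + 1) := by rintro rfl; rw [c1] at ha; exact absurd ha (by decide)
      have e1 : v = permChain q' (i + 1) := by
        funext x
        by_cases hx : x = q i.castSucc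
        · rw [hx, ha, c1']
        by_cases hx' : x = q i.succ
        · rw [hx', hb, c2']
        exact (hrest v (hle1 ⟨_, hb, Or.inr rfl⟩) (hle2 ⟨_, ha, Or.inl rfl⟩) x hx hx').2
      rw [if_pos ha, if_neg (by rw [hb]; decide), if_pos e1, if_neg n2]
    · have n2 : v ≠ permChain q' (i + 1) := by
        rintro rfl; rw [c1'] at ha; exact absurd ha (by decide)
      have e1 : v = permChain q (i + 1) := by
        funext x
        by_cases hx : x = q i.castSucc
        · rw [hx, ha, c1]
        by_cases hx' : x = q i.succ
        · rw [hx', hb, c2]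
        exact (hrest v (hle1 ⟨_, ha, Or.inl rfl⟩) (hle2 ⟨_, hb, Or.inr rfl⟩) x hx hx').1
      rw [if_neg (by rw [ha]; decide), if_pos hb, if_neg n2, if_pos e1]
    · have n1 : v ≠ permChain q' (i + 1) := by
        rintro rfl; rw [c1'] at ha; exact absurd ha (by decide)
      have n2 : v ≠ permChain q (i + 1) := by rintro rfl; rw [c2] at hb; exact absurd hb (by decide)
      simp [ha, hb, n1, n2]
  have hsum := Finset.sum_congr (rfl : (Finset.univ : Finset (Cube (n + 1))) = _)
    fun v _ => key v
  rw [Finset.sum_sub_distrib, Finset.sum_sub_distrib, ← Finset.sum_filter, ← Finset.sum_filter,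
    hα, hβ, Finset.sum_ite_eq', Finset.sum_ite_eq', if_pos (Finset.mem_univ _),
    if_pos (Finset.mem_univ _), sub_self] at hsum
  rw [hexp, hexp']
  exact sub_eq_zero.1 hsum.symm

theorem monoClass_permExponents (q : Equiv.Perm (Fin d)) :
    monoClass (permExponents q) = monoClass (permExponents 1) := by
  cases d with
  | zero => rw [Subsingleton.elim q 1]
  | succ n =>
    have hq : q ∈ Submonoid.closure
        (Set.range fun i : Fin n => Equiv.swap i.castSucc i.succ) := by
      rw [Equiv.Perm.mclosure_swap_castSucc_succ]; trivial
    induction hq using Submonoid.closure_induction_right with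
    | one => rfl
    | mul_right x _ y hy ih =>
      obtain ⟨i, rfl⟩ := hy
      rw [monoClass_permExponents_mul_swap, ih]

theorem length_injOn {S : Finset (Cube d)} (hS : IsChain (· ≤ ·) (S : Set (Cube d))) :
    Set.InjOn length (S : Set (Cube d)) := by
  intro v hv w hw h
  rcases hS.total hv hw with h' | h'
  · exact eq_of_le_of_length_le h' h.ge
  · exact (eq_of_le_of_length_le h' h.le).symm

theorem image_length_subset (S : Finset (Cube d)) : S.image length ⊆ Finset.range (d + 1) := by
  intro j hj
  obtain ⟨v, _, rfl⟩ := Finset.mem_image.1 hj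
  exact Finset.mem_range.2 (Nat.lt_succ_of_le (length_le v))

theorem card_le_of_isChain {S : Finset (Cube d)} (hS : IsChain (· ≤ ·) (S : Set (Cube d))) :
    S.card ≤ d + 1 := by
  rw [← Finset.card_image_of_injOn (length_injOn hS)]
  simpa using Finset.card_le_card (image_length_subset S)

/-- The `d + 1` vertices of the support have distinct lengths in `{0, …, d}`, so every length occurs
exactly once. -/
theorem exists_permExponents_eq {s : Cube d →₀ ℕ}
    (hs : IsChain (· ≤ ·) (s.support : Set (Cube d))) (hdeg : s.degree = d + 1)
    (hone : ∀ v, s v ≤ 1) : ∃ q, s = permExponents q := by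
  have hval : ∀ v ∈ s.support, s v = 1 := fun v hv =>
    le_antisymm (hone v) (Nat.one_le_iff_ne_zero.2 (Finsupp.mem_support_iff.1 hv))
  have hcard : s.support.card = d + 1 := by
    rw [← hdeg, Finsupp.degree_apply, Finset.sum_congr rfl hval]
    simp
  have himage : s.support.image length = Finset.range (d + 1) := by
    refine Finset.eq_of_subset_of_card_le (image_length_subset _) ?_
    rw [Finset.card_image_of_injOn (length_injOn hs), hcard, Finset.card_range]
  have h : ∀ j : Fin (d + 1), ∃ v ∈ s.support, length v = j := by
    intro j
    rw [← Finset.mem_image, himage]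
    exact Finset.mem_range.2 j.2
  choose σ hσ hlen using h
  have hmono : StrictMono σ := by
    intro j j' hjj
    have hne : σ j ≠ σ j' := fun h => by
      have := congrArg length h
      rw [hlen, hlen] at this
      exact hjj.ne (Fin.ext this)
    refine lt_of_le_of_ne ((hs.total (hσ j) (hσ j')).resolve_right fun h => ?_) hne
    have := length_mono h
    rw [hlen, hlen] at this
    exact absurd hjj (not_lt.2 this)
  obtain ⟨q, hq⟩ := exists_permChain hmono
  refine ⟨q, ?_⟩
  have hsupp : s.support = Finset.univ.image σ := by
    symm
    refine Finset.eq_of_subset_of_card_le ?_ ?_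
    · intro v hv
      obtain ⟨j, _, rfl⟩ := Finset.mem_image.1 hv
      exact hσ j
    · rw [Finset.card_image_of_injective _ hmono.injective, hcard]
      simp
  conv_lhs => rw [← Finsupp.sum_single s]
  rw [Finsupp.sum, hsupp, Finset.sum_image fun _ _ _ _ h => hmono.injective h, permExponents]
  refine Finset.sum_congr rfl fun j _ => ?_
  rw [← hq, hval _ (hσ j)]

theorem exists_zero_one_of_lt {a b : Cube d} (h : a < b) : ∃ i, a i = 0 ∧ b i = 1 := by
  obtain ⟨i, hi⟩ := (Pi.lt_def.1 h).2
  have h1 := hi.trans_le (Fin.le_last _)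
  have h0 := (Fin.zero_le _).trans_lt hi
  exact ⟨i, by omega, by omega⟩

/-- A relation among the classes `m * C_v` in which exactly the vertices of `m` up to `u` occur. -/
theorem exists_relation_le {m : Cube d →₀ ℕ} (hm : IsChain (· ≤ ·) (m.support : Set (Cube d)))
    {u : Cube d} (hu : m u ≠ 0) :
    ∃ ε : Cube d → ℤ, ∑ v, ε v • monoClass (m + Finsupp.single v 1) = 0 ∧
      ∀ v, m v ≠ 0 → (v ≤ u → ε v = 1) ∧ (¬ v ≤ u → ε v = 0) := by
  classical
  -- If `u` is the top of the chain, the sum over all vertices serves. Otherwise the slice uses a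
  -- coordinate that changes between `u` and its successor in the chain.
  rcases (m.support.filter (u < ·)).eq_empty_or_nonempty with h | h
  · refine ⟨fun _ => 1, ?_, fun v hv => ⟨fun _ => rfl, fun h' => ?_⟩⟩
    · simp only [one_smul]
      exact sum_monoClass_total (by rintro rfl; simp at hu)
    · have hle := (hm.total (Finsupp.mem_support_iff.2 hv)
        (Finsupp.mem_support_iff.2 hu)).resolve_left h'
      have : v ∈ m.support.filter (u < ·) :=
        Finset.mem_filter.2 ⟨Finsupp.mem_support_iff.2 hv,
          lt_of_le_of_ne hle (by rintro rfl; exact h' le_rfl)⟩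
      rw [h] at this
      simp at this
  · obtain ⟨w, hw, hmin⟩ := Finset.exists_min_image _ length h
    rw [Finset.mem_filter, Finsupp.mem_support_iff] at hw
    obtain ⟨i, hui, hwi⟩ := exists_zero_one_of_lt hw.2
    refine ⟨fun v => if v i = 0 then 1 else 0, ?_, fun v hv => ⟨fun h' => ?_, fun h' => ?_⟩⟩
    · have := sum_monoClass_slice hu hw.1 hui hwi
      rw [Finset.sum_filter] at this
      simpa only [ite_smul, one_smul, zero_smul] using this
    · refine if_pos ?_
      have := h' i
      rw [hui] at this
      exact le_antisymm this (Fin.zero_le _)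
    · have hle := (hm.total (Finsupp.mem_support_iff.2 hv)
        (Finsupp.mem_support_iff.2 hu)).resolve_left h'
      have hlen := hmin v (Finset.mem_filter.2 ⟨Finsupp.mem_support_iff.2 hv,
          lt_of_le_of_ne hle (by rintro rfl; exact h' le_rfl)⟩)
      have hwv : w ≤ v := by
        rcases hm.total (Finsupp.mem_support_iff.2 hw.1) (Finsupp.mem_support_iff.2 hv) with h | h
        · exact h
        · exact (eq_of_le_of_length_le h hlen).ge
      refine if_neg fun h0 => ?_
      have := hwv i
      rw [hwi, h0] at this
      exact absurd this (Fin.not_le.2 Fin.zero_lt_one)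

/-- A relation among the classes `m * C_v` in which exactly the vertices of `m` below `u` occur. -/
theorem exists_relation_lt {m : Cube d →₀ ℕ} (hm : IsChain (· ≤ ·) (m.support : Set (Cube d)))
    {u : Cube d} (hu : m u ≠ 0) :
    ∃ ε : Cube d → ℤ, ∑ v, ε v • monoClass (m + Finsupp.single v 1) = 0 ∧
      ∀ v, m v ≠ 0 → (v < u → ε v = 1) ∧ (¬ v < u → ε v = 0) := by
  classical
  -- If `u` is the bottom of the chain, the trivial relation serves. Otherwise the slice uses a
  -- coordinate that changes between the predecessor of `u` and `u`.
  rcases (m.support.filter (· < u)).eq_empty_or_nonempty with h | h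
  · refine ⟨fun _ => 0, by simp, fun v hv => ⟨fun h' => ?_, fun _ => rfl⟩⟩
    have : v ∈ m.support.filter (· < u) :=
      Finset.mem_filter.2 ⟨Finsupp.mem_support_iff.2 hv, h'⟩
    rw [h] at this
    simp at this
  · obtain ⟨w, hw, hmax⟩ := Finset.exists_max_image _ length h
    rw [Finset.mem_filter, Finsupp.mem_support_iff] at hw
    obtain ⟨i, hwi, hui⟩ := exists_zero_one_of_lt hw.2
    refine ⟨fun v => if v i = 0 then 1 else 0, ?_, fun v hv => ⟨fun h' => ?_, fun h' => ?_⟩⟩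
    · have := sum_monoClass_slice hw.1 hu hwi hui
      rw [Finset.sum_filter] at this
      simpa only [ite_smul, one_smul, zero_smul] using this
    · have hlen := hmax v (Finset.mem_filter.2 ⟨Finsupp.mem_support_iff.2 hv, h'⟩)
      have hwv : v ≤ w := by
        rcases hm.total (Finsupp.mem_support_iff.2 hw.1) (Finsupp.mem_support_iff.2 hv) with h | h
        · exact (eq_of_le_of_length_le h hlen).ge
        · exact h
      refine if_pos ?_
      have := hwv i
      rw [hwi] at this
      exact le_antisymm this (Fin.zero_le _)
    · have hle : u ≤ v := by
        rcases hm.total (Finsupp.mem_support_iff.2 hv) (Finsupp.mem_support_iff.2 hu) with h | h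
        · by_contra hne
          exact h' (lt_of_le_of_ne h (by rintro rfl; exact hne le_rfl))
        · exact h
      refine if_neg fun h0 => ?_
      have := hle i
      rw [hui, h0] at this
      exact absurd this (Fin.not_le.2 Fin.zero_lt_one)

/-- Induction on the number of vertices by which the support falls short of a maximal chain. As long
as some exponent exceeds one, the monomial is a combination of monomials that either vanish or have
one more vertex in their support. -/
theorem monoClass_mem_span (s : Cube d →₀ ℕ) (hdeg : s.degree = d + 1) :
    monoClass s ∈ Submodule.span ℤ {monoClass (permExponents (1 : Equiv.Perm (Fin d)))} := by
  classical
  induction h : d + 1 - s.support.card using Nat.strong_induction_on generalizing s with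
  | _ N ih =>
    by_cases hs : IsChain (· ≤ ·) (s.support : Set (Cube d))
    swap
    · rw [monoClass_of_not_isChain hs]
      exact Submodule.zero_mem _
    by_cases hone : ∀ v, s v ≤ 1
    · obtain ⟨q, rfl⟩ := exists_permExponents_eq hs hdeg hone
      rw [monoClass_permExponents q]
      exact Submodule.subset_span rfl
    · push Not at hone
      obtain ⟨u, hu⟩ := hone
      obtain ⟨m, hm⟩ : ∃ m, s = m + Finsupp.single u 1 :=
        ⟨s - Finsupp.single u 1, (tsub_add_cancel_of_le (Finsupp.single_le_iff.2 hu.le)).symm⟩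
      have hmu : m u ≠ 0 := by
        rw [hm, Finsupp.add_apply, Finsupp.single_eq_same] at hu
        omega
      have hsupp : m.support = s.support := by
        ext v
        rw [Finsupp.mem_support_iff, Finsupp.mem_support_iff, hm, Finsupp.add_apply]
        by_cases hv : v = u
        · subst hv; simp [hmu]
        · rw [Finsupp.single_eq_of_ne hv, add_zero]
      have hmc : IsChain (· ≤ ·) (m.support : Set (Cube d)) := by rwa [hsupp]
      obtain ⟨ε, hε, hεm⟩ := exists_relation_le hmc hmu
      obtain ⟨δ, hδ, hδm⟩ := exists_relation_lt hmc hmu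
      -- Among the vertices of `m`, the difference of the two relations retains only `u`, with
      -- coefficient one.
      have hrel : ∑ v, (ε v - δ v) • monoClass (m + Finsupp.single v 1) = 0 := by
        simp only [sub_smul, Finset.sum_sub_distrib, hε, hδ, sub_zero]
      have hu1 : ε u - δ u = 1 := by
        rw [(hεm u hmu).1 le_rfl, (hδm u hmu).2 (lt_irrefl u), sub_zero]
      rw [← Finset.add_sum_erase _ _ (Finset.mem_univ u), hu1, one_smul, ← hm] at hrel
      rw [eq_neg_of_add_eq_zero_left hrel]
      refine Submodule.neg_mem _ (Submodule.sum_mem _ fun v hv => ?_)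
      have hvu : v ≠ u := (Finset.mem_erase.1 hv).1
      by_cases hmv : m v = 0
      · refine Submodule.smul_mem _ _ ?_
        by_cases hc : IsChain (· ≤ ·) ((m + Finsupp.single v 1).support : Set (Cube d))
        swap
        · rw [monoClass_of_not_isChain hc]
          exact Submodule.zero_mem _
        have hins : (m + Finsupp.single v 1).support = insert v m.support := by
          ext w
          rw [Finset.mem_insert, Finsupp.mem_support_iff, Finsupp.mem_support_iff,
            Finsupp.add_apply]
          by_cases hw : w = v
          · subst hw; simp
          · rw [Finsupp.single_eq_of_ne hw]; simp [hw]
        have hcard : (m + Finsupp.single v 1).support.card = s.support.card + 1 := by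
          rw [hins, Finset.card_insert_of_notMem (by simp [hmv]), hsupp]
        have hle := card_le_of_isChain hc
        refine ih _ ?_ (m + Finsupp.single v 1) ?_ rfl
        · omega
        · rw [hm, map_add, Finsupp.degree_single] at hdeg
          rw [map_add, Finsupp.degree_single, hdeg]
      · have h0 : ε v - δ v = 0 := by
          by_cases hle : v ≤ u
          · rw [(hεm v hmv).1 hle, (hδm v hmv).1 (lt_of_le_of_ne hle hvu), sub_self]
          · rw [(hεm v hmv).2 hle, (hδm v hmv).2 (fun h => hle h.le), sub_self]
        rw [h0, zero_smul]
        exact Submodule.zero_mem _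

theorem chowPiece_le_span : chowPiece (cubeGraphs d) (d + 1) ≤
    Submodule.span ℤ {monoClass (permExponents (1 : Equiv.Perm (Fin d)))} := by
  rintro _ ⟨p, hp, rfl⟩
  rw [SetLike.mem_coe, mem_homogeneousSubmodule] at hp
  rw [p.as_sum, map_sum]
  refine Submodule.sum_mem _ fun s hs => ?_
  have hdeg : s.degree = d + 1 := by
    have := hp (mem_support_iff.1 hs)
    rw [Finsupp.degree_eq_weight_one]
    exact this
  have : monomial s (coeff s p) = coeff s p • monomial s (1 : ℤ) := by simp [smul_monomial]
  rw [this, map_smul]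
  exact Submodule.smul_mem _ _ (monoClass_mem_span s hdeg)

end Generation

/-! ### The forced numbers of chips going left and right -/

section Split

variable {k : ℕ} (l n : Fin (k + 1) → ℕ)

/-- The number of chips which have to go from the `i`-th occupied point to the right. -/
def rightChips (i : Fin (k + 1)) : ℤ := ∑ j ∈ Finset.Iic i, (n j : ℤ) - l i - 1

/-- The number of chips which have to go from the `i`-th occupied point to the left. -/
def leftChips (i : Fin (k + 1)) : ℤ := l i - ∑ j ∈ Finset.Iio i, (n j : ℤ)

theorem leftChips_zero : leftChips l n 0 = l 0 := by
  have : Finset.Iio (0 : Fin (k + 1)) = ∅ := by ext i; simp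
  simp [leftChips, this]

theorem rightChips_eq (i : Fin (k + 1)) : rightChips l n i = n i - 1 - leftChips l n i := by
  rw [rightChips, leftChips, ← Finset.Iio_insert i, Finset.sum_insert (by simp)]
  ring

theorem leftChips_succ (i : Fin k) : leftChips l n i.succ =
    l i.succ - l i.castSucc - 1 - rightChips l n i.castSucc := by
  have : Finset.Iio i.succ = Finset.Iic i.castSucc := by
    ext j; rw [Finset.mem_Iio, Finset.mem_Iic, Fin.lt_def, Fin.le_def]; simp
  rw [rightChips, leftChips, this]
  ring

theorem rightChips_last {d : ℕ} (hsum : ∑ i, n i = d + 1) :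
    rightChips l n (Fin.last k) = d - l (Fin.last k) := by
  have : Finset.Iic (Fin.last k) = Finset.univ := by ext i; simp [Fin.le_last]
  rw [rightChips, this]
  have : ∑ i, (n i : ℤ) = d + 1 := by exact_mod_cast hsum
  rw [this]
  ring

/-- The numbers of chips going left and right are determined by the points and the chips. -/
theorem chips_unique {x y : Fin (k + 1) → ℤ} (h0 : y 0 = l 0)
    (hs : ∀ i : Fin k, y i.succ = l i.succ - l i.castSucc - 1 - x i.castSucc)
    (hx : ∀ i, x i = n i - 1 - y i) (i : Fin (k + 1)) :
    y i = leftChips l n i ∧ x i = rightChips l n i := by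
  have key : ∀ i, y i = leftChips l n i := by
    intro i
    induction i using Fin.induction with
    | zero => rw [leftChips_zero, h0]
    | succ i ih => rw [leftChips_succ, hs, hx, ih, rightChips_eq]
  exact ⟨key i, by rw [hx, rightChips_eq, key]⟩

/-- The first kind of overflow is a negative `leftChips` at a vertex other than the first. The
second is a negative `rightChips` at a vertex other than the last, after passing to complementary
sums. At the two ends the numbers are `length (v 0)` and `d - length (v (Fin.last k))`, which are
never negative. -/
theorem overflows_iff {d : ℕ} (v : Fin (k + 1) → Cube d) (hsum : ∑ i, n i = d + 1) :
    Overflows v n ↔ ∃ i, leftChips (fun i => length (v i)) n i < 0 ∨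
      rightChips (fun i => length (v i)) n i < 0 := by
  have hsum' : ∑ i, (n i : ℤ) = d + 1 := by exact_mod_cast hsum
  have hleft : ∀ i : Fin k, leftChips (fun i => length (v i)) n i.succ < 0 ↔
      length (v i.succ) < ∑ j ∈ Finset.Iic i.castSucc, n j := by
    intro i
    rw [leftChips_succ, rightChips]
    zify
    constructor <;> intro h <;> linarith
  have hright : ∀ i : Fin k, rightChips (fun i => length (v i)) n i.castSucc < 0 ↔
      (d : ℤ) - length (v i.castSucc) < ∑ j ∈ Finset.Ici i.succ, (n j : ℤ) := by
    intro i
    have hc : Finset.Ici i.succ = (Finset.Iic i.castSucc)ᶜ := by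
      ext j
      rw [Finset.mem_compl, Finset.mem_Ici, Finset.mem_Iic, Fin.le_def, Fin.le_def]
      simp
    have h := Finset.sum_add_sum_compl (Finset.Iic i.castSucc) (fun j => (n j : ℤ))
    rw [← hc, hsum'] at h
    rw [rightChips]
    constructor <;> intro h <;> linarith
  constructor
  · rintro (⟨i, hi⟩ | ⟨i, hi⟩)
    · exact ⟨i.succ, Or.inl ((hleft i).2 hi)⟩
    · exact ⟨i.castSucc, Or.inr ((hright i).2 hi)⟩
  · rintro ⟨i, hi | hi⟩
    · cases i using Fin.cases with
      | zero => rw [leftChips_zero] at hi; omega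
      | succ i => exact Or.inl ⟨i, (hleft i).1 hi⟩
    · cases i using Fin.lastCases with
      | last =>
        rw [rightChips_last _ _ hsum] at hi
        have := length_le (v (Fin.last k))
        omega
      | cast i => exact Or.inr ⟨i, (hright i).1 hi⟩

end Split

/-! ### The degree map and its values on monomials -/

section Formula

variable {d : ℕ}

theorem weight_ofFn {k : ℕ} (v : Fin (k + 1) → Cube d) (n : Fin (k + 1) → ℕ)
    (x y : Fin (k + 1) → ℤ) (hv : StrictMono v) (hx : ∀ i, x i = n i - 1 - y i)
    (hs : ∀ i : Fin k, y i.succ = length (v i.succ) - length (v i.castSucc) - 1 - x i.castSucc)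
    (hl : x (Fin.last k) = d - length (v (Fin.last k))) :
    weight (v 0) (x 0) (List.ofFn fun i : Fin k => (v i.succ, n i.succ)) =
      (∏ i : Fin k, binomMix (x i.castSucc) (y i.succ)) *
        ∏ i : Fin k, ((-1) ^ (n i.succ + 1) * binomMix (y i.succ) (x i.succ)) := by
  induction k with
  | zero =>
    have hl' : x 0 = d - length (v 0) := hl
    simp [weight, hl']
  | succ k ih =>
    rw [List.ofFn_succ, weight_cons_of_lt (hv (Fin.succ_pos 0)) (x 0) (y (Fin.succ 0)) _ _ (hs 0),
      ← hx, Fin.prod_univ_succ, Fin.prod_univ_succ]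
    have := ih (fun i => v i.succ) (fun i => n i.succ) (fun i => x i.succ) (fun i => y i.succ)
      (hv.comp (Fin.strictMono_succ)) (fun i => hx _) (fun i => hs i.succ) hl
    rw [this]
    simp only [Fin.castSucc_zero, Fin.succ_castSucc]
    ring

theorem chainWeight_ofFn {k : ℕ} (v : Fin (k + 1) → Cube d) (n : Fin (k + 1) → ℕ)
    (hv : StrictMono v) (hsum : ∑ i, n i = d + 1) :
    chainWeight (List.ofFn fun i => (v i, n i)) =
      (∏ i : Fin k, binomMix (rightChips (fun i => length (v i)) n i.castSucc)
        (leftChips (fun i => length (v i)) n i.succ)) *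
      ∏ i, ((-1) ^ (n i + 1) * binomMix (leftChips (fun i => length (v i)) n i)
        (rightChips (fun i => length (v i)) n i)) := by
  rw [List.ofFn_succ, chainWeight_cons, Fin.prod_univ_succ]
  have h0 := leftChips_zero (fun i => length (v i)) n
  have h1 := rightChips_eq (fun i => length (v i)) n 0
  rw [h0] at h1
  rw [← h1, weight_ofFn v n _ _ hv (rightChips_eq _ n) (leftChips_succ _ n)
    (rightChips_last _ n hsum), h0]
  ring

theorem isChainList_ofFn {k : ℕ} (v : Fin k → Cube d) (n : Fin k → ℕ) (hv : StrictMono v)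
    (hn : ∀ i, 1 ≤ n i) : IsChainList (List.ofFn fun i => (v i, n i)) := by
  refine ⟨List.pairwise_ofFn.2 fun i j hij => hv hij, fun p hp => ?_⟩
  obtain ⟨i, rfl⟩ := (List.mem_ofFn' _ _).1 hp
  exact hn i

theorem exponents_ofFn {k : ℕ} (v : Fin k → Cube d) (n : Fin k → ℕ) :
    exponents (List.ofFn fun i => (v i, n i)) = ∑ i, Finsupp.single (v i) (n i) := by
  rw [exponents, List.map_ofFn, List.sum_ofFn]
  rfl

theorem prod_vertexClass_pow {k : ℕ} (v : Fin k → Cube d) (n : Fin k → ℕ) :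
    ∏ i, vertexClass (cubeGraphs d) (v i) ^ n i =
      monoClass (∑ i, Finsupp.single (v i) (n i)) := by
  rw [monoClass, MvPolynomial.monomial_sum_one, map_prod]
  refine Finset.prod_congr rfl fun i _ => ?_
  rw [vertexClass, ← map_pow, MvPolynomial.X_pow_eq_monomial]

theorem chowDegree_prod_vertexClass_pow {k : ℕ} (v : Fin (k + 1) → Cube d) (n : Fin (k + 1) → ℕ)
    (hv : StrictMono v) (hn : ∀ i, 1 ≤ n i) (hsum : ∑ i, n i = d + 1) :
    chowDegree d (∏ i, vertexClass (cubeGraphs d) (v i) ^ n i) =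
      (∏ i : Fin k, binomMix (rightChips (fun i => length (v i)) n i.castSucc)
        (leftChips (fun i => length (v i)) n i.succ)) *
      ∏ i, ((-1) ^ (n i + 1) * binomMix (leftChips (fun i => length (v i)) n i)
        (rightChips (fun i => length (v i)) n i)) := by
  rw [prod_vertexClass_pow, chowDegree_monoClass, ← exponents_ofFn,
    chainCoeff_exponents (isChainList_ofFn v n hv hn), chainWeight_ofFn v n hv hsum]

theorem chowDegree_simplexClass {σ : Fin (d + 1) → Cube d} (hσ : StrictMono σ) :
    chowDegree d (simplexClass (cubeGraphs d) σ : ChowRing (cubeGraphs d)) = 1 := by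
  -- The lengths form a strictly increasing self-map of `Fin (d + 1)`, which is the identity. So no
  -- chip moves, and all binomials and signs are one.
  have hlen : ∀ i, length (σ i) = (i : ℕ) := by
    have hmono : StrictMono fun i =>
        (⟨length (σ i), Nat.lt_succ_of_le (length_le _)⟩ : Fin (d + 1)) :=
      fun i j hij => length_strictMono (hσ hij)
    intro i
    have := congrFun ((hmono.range_inj strictMono_id).1 (by
      rw [(Finite.injective_iff_surjective.1 hmono.injective).range_eq]; simp)) i
    exact congrArg Fin.val this
  have hu := chips_unique (fun i => length (σ i)) (fun _ => 1) (x := fun _ => 0) (y := fun _ => 0)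
    (by simp [hlen]) (fun i => by simp [hlen]) (fun i => by simp)
  have := chowDegree_prod_vertexClass_pow σ (fun _ => 1) hσ (fun _ => le_rfl) (by simp)
  simp only [← (hu _).1, ← (hu _).2] at this
  rw [simplexClass, monomialClass, this]
  simp [binomMix]

/-- The top graded piece is generated by the class of a maximal chain. -/
theorem exists_generator (d : ℕ) : ∃ σ : Fin (d + 1) → Cube d, StrictMono σ ∧
    ∀ c : chowPiece (cubeGraphs d) (d + 1), ∃ z : ℤ, z • simplexClass (cubeGraphs d) σ = c := by
  obtain ⟨σ, hσ⟩ : ∃ σ : Fin (d + 1) → Cube d, ∀ j, σ j = permChain 1 j := ⟨_, fun _ => rfl⟩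
  have hmono : StrictMono σ := by
    intro i j hij
    rw [hσ, hσ]
    refine lt_of_le_of_ne (fun x => ?_) fun h => ?_
    · by_cases hx : permChain (1 : Equiv.Perm (Fin d)) i x = 1
      · rw [hx, permChain_eq_one.2 ((permChain_eq_one.1 hx).trans hij)]
      · rw [show permChain (1 : Equiv.Perm (Fin d)) i x = 0 by omega]
        exact Fin.zero_le _
    · have h1 := congrFun h ⟨i, by omega⟩
      have h2 : permChain (1 : Equiv.Perm (Fin d)) i ⟨i, by omega⟩ = 0 := permChain_eq_zero.2 le_rfl
      have h3 : permChain (1 : Equiv.Perm (Fin d)) j ⟨i, by omega⟩ = 1 := permChain_eq_one.2 hij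
      exact Fin.zero_ne_one (h2.symm.trans (h1.trans h3))
  have hgen : (simplexClass (cubeGraphs d) σ : ChowRing (cubeGraphs d)) =
      monoClass (permExponents 1) := by
    rw [simplexClass, monomialClass]
    simp only [prod_vertexClass_pow, hσ]
    rfl
  refine ⟨σ, hmono, fun c => ?_⟩
  obtain ⟨z, hz⟩ := Submodule.mem_span_singleton.1 (chowPiece_le_span c.2)
  exact ⟨z, Subtype.ext (by rw [Submodule.coe_smul, hgen, hz])⟩

/-- The generator has `chowDegree` one, so no nonzero multiple of it vanishes and the cyclic group
is `ℤ`. -/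
theorem exists_isDegreeMap (d : ℕ) :
    ∃ deg : chowPiece (cubeGraphs d) (d + 1) ≃ₗ[ℤ] ℤ, IsDegreeMap d deg := by
  obtain ⟨σ, hmono, hspan⟩ := exists_generator d
  have hdeg := chowDegree_simplexClass hmono
  refine ⟨LinearEquiv.ofBijective
    ((chowDegree d).comp (chowPiece (cubeGraphs d) (d + 1)).subtype) ⟨?_, ?_⟩,
    fun τ hτ => chowDegree_simplexClass hτ.2⟩
  · rw [← LinearMap.ker_eq_bot, LinearMap.ker_eq_bot']
    intro c hc
    obtain ⟨z, rfl⟩ := hspan c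
    rw [map_smul, LinearMap.comp_apply, Submodule.subtype_apply, hdeg] at hc
    rw [show z = 0 by simpa using hc, zero_smul]
  · intro z
    refine ⟨z • simplexClass (cubeGraphs d) σ, ?_⟩
    rw [map_smul, LinearMap.comp_apply, Submodule.subtype_apply, hdeg]
    simp

theorem IsDegreeMap.eq_chowDegree {deg : chowPiece (cubeGraphs d) (d + 1) ≃ₗ[ℤ] ℤ}
    (h : IsDegreeMap d deg) (c : chowPiece (cubeGraphs d) (d + 1)) : deg c = chowDegree d c := by
  obtain ⟨σ, hmono, hspan⟩ := exists_generator d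
  obtain ⟨z, rfl⟩ := hspan c
  rw [map_smul, h σ ⟨isSimplex_of_monotone hmono.monotone, hmono⟩, Submodule.coe_smul, map_smul,
    chowDegree_simplexClass hmono]

end Formula

/-! ### Gaps between the occupied points -/

section Gaps

variable {k : ℕ} {d : ℕ} {l n : Fin (k + 1) → ℕ}

/-- The free points between the occupied points `l (j - 1)` and `l j`, where the first and the last
gap are bounded by the ends of `{0, …, d}`. -/
def gap (d : ℕ) (l : Fin (k + 1) → ℕ) (j : Fin (k + 2)) : Finset ℕ :=
  (Finset.range (d + 1)).filter fun p =>
    ∀ i, (i.castSucc < j → l i < p) ∧ (j ≤ i.castSucc → p < l i)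

theorem mem_gap {j : Fin (k + 2)} {p : ℕ} : p ∈ gap d l j ↔
    p ≤ d ∧ ∀ i, (i.castSucc < j → l i < p) ∧ (j ≤ i.castSucc → p < l i) := by
  rw [gap, Finset.mem_filter, Finset.mem_range, Nat.lt_succ_iff]

theorem lt_of_mem_gap_castSucc {i : Fin (k + 1)} {p : ℕ} (h : p ∈ gap d l i.castSucc) : p < l i :=
  ((mem_gap.1 h).2 i).2 le_rfl

theorem lt_of_mem_gap_succ {i : Fin (k + 1)} {p : ℕ} (h : p ∈ gap d l i.succ) : l i < p :=
  ((mem_gap.1 h).2 i).1 i.castSucc_lt_succ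

theorem ne_of_mem_gap {j : Fin (k + 2)} {p : ℕ} (h : p ∈ gap d l j) (i : Fin (k + 1)) :
    l i ≠ p := by
  rcases lt_or_ge i.castSucc j with hi | hi
  · exact (((mem_gap.1 h).2 i).1 hi).ne
  · exact (((mem_gap.1 h).2 i).2 hi).ne'

theorem gap_unique {j j' : Fin (k + 2)} {p : ℕ} (h : p ∈ gap d l j) (h' : p ∈ gap d l j') :
    j = j' := by
  have key : ∀ {j j' : Fin (k + 2)}, p ∈ gap d l j → p ∈ gap d l j' → ¬ j < j' := by
    intro j j' h h' hlt
    cases j using Fin.lastCases with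
    | last => exact absurd hlt (not_lt.2 (Fin.le_last _))
    | cast i => exact absurd (lt_of_mem_gap_castSucc h) (((mem_gap.1 h').2 i).1 hlt).not_gt
  exact le_antisymm (not_lt.1 (key h' h)) (not_lt.1 (key h h'))

theorem exists_gap (hl : StrictMono l) {p : ℕ} (hp : p ≤ d) (hfree : ∀ i, l i ≠ p) :
    ∃ j, p ∈ gap d l j := by
  rcases (Finset.univ.filter fun i => p < l i).eq_empty_or_nonempty with h | h
  · refine ⟨Fin.last _, mem_gap.2 ⟨hp, fun i => ⟨fun _ => ?_, fun hi => ?_⟩⟩⟩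
    · have : ¬ p < l i := fun hi => by
        have : i ∈ Finset.univ.filter fun i => p < l i := by simpa using hi
        rw [h] at this
        simp at this
      exact lt_of_le_of_ne (not_lt.1 this) (hfree i)
    · exact absurd (Fin.castSucc_lt_last i) (not_lt.2 hi)
  · obtain ⟨i, hi, hmin⟩ := Finset.exists_min_image _ id h
    rw [Finset.mem_filter] at hi
    refine ⟨i.castSucc, mem_gap.2 ⟨hp, fun j => ⟨fun hj => ?_, fun hj => ?_⟩⟩⟩
    · have : ¬ p < l j := fun h' => by
        have := hmin j (by simpa using h')
        exact absurd (Fin.castSucc_lt_castSucc_iff.1 hj) (not_lt.2 this)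
      exact lt_of_le_of_ne (not_lt.1 this) (hfree j)
    · exact hi.2.trans_le (hl.monotone (Fin.castSucc_le_castSucc_iff.1 hj))

theorem isNeighbor_of_mem_gap_castSucc (hl : StrictMono l) {i : Fin (k + 1)} {p : ℕ}
    (h : p ∈ gap d l i.castSucc) : IsNeighbor l i p := by
  intro j hj
  rw [Set.uIcc_of_le (lt_of_mem_gap_castSucc h).le] at hj
  rcases lt_or_ge j i with hji | hji
  · have := ((mem_gap.1 h).2 j).1 (Fin.castSucc_lt_castSucc_iff.2 hji)
    exact absurd hj.1 (not_le.2 this)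
  · exact le_antisymm hj.2 (hl.monotone hji)

theorem isNeighbor_of_mem_gap_succ (hl : StrictMono l) {i : Fin (k + 1)} {p : ℕ}
    (h : p ∈ gap d l i.succ) : IsNeighbor l i p := by
  intro j hj
  rw [Set.uIcc_of_ge (lt_of_mem_gap_succ h).le] at hj
  rcases lt_or_ge i j with hji | hji
  · have := ((mem_gap.1 h).2 j).2 (by rw [Fin.le_def]; simpa using hji)
    exact absurd hj.2 (not_le.2 this)
  · exact le_antisymm (hl.monotone hji) hj.1

/-- An occupied point to the left of `l i` that is not to the left of `p` would lie in the interval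
between `p` and `l i`. -/
theorem mem_gap_castSucc_of_isNeighbor (hl : StrictMono l) {i : Fin (k + 1)} {p : ℕ} (hp : p ≤ d)
    (h : IsNeighbor l i p) (hi : p < l i) : p ∈ gap d l i.castSucc := by
  refine mem_gap.2 ⟨hp, fun j => ⟨fun hj => ?_, fun hj => ?_⟩⟩
  · have hji := hl (Fin.castSucc_lt_castSucc_iff.1 hj)
    by_contra hpj
    refine hji.ne (h j ?_)
    rw [Set.uIcc_of_le hi.le]
    exact ⟨not_lt.1 hpj, hji.le⟩
  · exact hi.trans_le (hl.monotone (Fin.castSucc_le_castSucc_iff.1 hj))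

theorem mem_gap_succ_of_isNeighbor (hl : StrictMono l) {i : Fin (k + 1)} {p : ℕ} (hp : p ≤ d)
    (h : IsNeighbor l i p) (hi : l i < p) : p ∈ gap d l i.succ := by
  refine mem_gap.2 ⟨hp, fun j => ⟨fun hj => ?_, fun hj => ?_⟩⟩
  · have hji : j ≤ i := by rw [Fin.lt_def] at hj; rw [Fin.le_def]; simpa [Nat.lt_succ_iff] using hj
    exact (hl.monotone hji).trans_lt hi
  · have hji : i < j := by rw [Fin.le_def] at hj; rw [Fin.lt_def]; simpa using hj
    by_contra hpj
    refine (hl hji).ne' (h j ?_)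
    rw [Set.uIcc_of_ge hi.le]
    exact ⟨(hl hji).le, not_lt.1 hpj⟩

theorem card_gap_zero (hl : StrictMono l) (hd : ∀ i, l i ≤ d) : (gap d l 0).card = l 0 := by
  have : gap d l 0 = Finset.range (l 0) := by
    ext p
    rw [mem_gap, Finset.mem_range]
    refine ⟨fun h => (h.2 0).2 (Fin.zero_le _), fun h => ⟨h.le.trans (hd 0), fun i => ⟨fun hi => ?_,
      fun _ => h.trans_le (hl.monotone (Fin.zero_le _))⟩⟩⟩
    exact absurd hi (Fin.not_lt_zero _)
  rw [this, Finset.card_range]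

theorem card_gap_last (hl : StrictMono l) :
    (gap d l (Fin.last (k + 1))).card = d - l (Fin.last k) := by
  have : gap d l (Fin.last (k + 1)) = Finset.Ioc (l (Fin.last k)) d := by
    ext p
    rw [mem_gap, Finset.mem_Ioc]
    refine ⟨fun h => ⟨(h.2 (Fin.last k)).1 (Fin.castSucc_lt_last _), h.1⟩,
      fun h => ⟨h.2, fun i => ⟨fun _ => (hl.monotone (Fin.le_last i)).trans_lt h.1, fun hi => ?_⟩⟩⟩
    exact absurd (Fin.castSucc_lt_last i) (not_lt.2 hi)
  rw [this, Nat.card_Ioc]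

theorem card_gap_succ_castSucc (hl : StrictMono l) (hd : ∀ i, l i ≤ d) (i : Fin k) :
    (gap d l i.succ.castSucc).card = l i.succ - l i.castSucc - 1 := by
  have : gap d l i.succ.castSucc = Finset.Ioo (l i.castSucc) (l i.succ) := by
    ext p
    rw [Finset.mem_Ioo]
    constructor
    · intro h
      refine ⟨((mem_gap.1 h).2 i.castSucc).1 ?_, lt_of_mem_gap_castSucc h⟩
      exact Fin.castSucc_lt_castSucc_iff.2 i.castSucc_lt_succ
    · rintro ⟨h1, h2⟩
      refine mem_gap.2 ⟨h2.le.trans (hd _), fun j => ⟨fun hj => ?_, fun hj => ?_⟩⟩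
      · have hji : j ≤ i.castSucc := by
          rw [Fin.lt_def] at hj; rw [Fin.le_def]; simpa [Nat.lt_succ_iff] using hj
        exact (hl.monotone hji).trans_lt h1
      · exact h2.trans_le (hl.monotone (Fin.castSucc_le_castSucc_iff.1 hj))
  rw [this, Nat.card_Ioo]

end Gaps

/-! ### Counting chip placements -/

section Placements

variable {k : ℕ} {d : ℕ} {l n : Fin (k + 1) → ℕ}

/-- The chips at `l i` which go to the left. -/
def leftSet (f : ExtraChip n ≃ FreePoint d l) (i : Fin (k + 1)) : Finset (Fin (n i - 1)) :=
  Finset.univ.filter fun a => ((f ⟨i, a⟩).1 : ℕ) < l i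

/-- The points of a gap whose chip comes from the left. -/
def fromLeft (f : ExtraChip n ≃ FreePoint d l) (j : Fin (k + 2)) : Finset ℕ :=
  (gap d l j).filter fun p => ∃ c : ExtraChip n, c.1.succ = j ∧ ((f c).1 : ℕ) = p

theorem mem_leftSet {f : ExtraChip n ≃ FreePoint d l} {i : Fin (k + 1)} {a : Fin (n i - 1)} :
    a ∈ leftSet f i ↔ ((f ⟨i, a⟩).1 : ℕ) < l i := by
  simp [leftSet]

theorem mem_fromLeft {f : ExtraChip n ≃ FreePoint d l} {j : Fin (k + 2)} {p : ℕ} :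
    p ∈ fromLeft f j ↔ p ∈ gap d l j ∧ ∃ c : ExtraChip n, c.1.succ = j ∧ ((f c).1 : ℕ) = p := by
  rw [fromLeft, Finset.mem_filter]

theorem val_injective (f : ExtraChip n ≃ FreePoint d l) :
    Function.Injective fun c => ((f c).1 : ℕ) :=
  fun _ _ h => f.injective (Subtype.ext (Fin.ext h))

theorem mem_gap_of_mem_leftSet (hl : StrictMono l) {f : ExtraChip n ≃ FreePoint d l}
    (hf : f ∈ chipPlacements d l n) {i : Fin (k + 1)} {a : Fin (n i - 1)} (ha : a ∈ leftSet f i) :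
    ((f ⟨i, a⟩).1 : ℕ) ∈ gap d l i.castSucc :=
  mem_gap_castSucc_of_isNeighbor hl (Nat.lt_succ_iff.1 (f ⟨i, a⟩).1.2) (hf ⟨i, a⟩)
    (mem_leftSet.1 ha)

theorem mem_gap_of_notMem_leftSet (hl : StrictMono l) {f : ExtraChip n ≃ FreePoint d l}
    (hf : f ∈ chipPlacements d l n) {i : Fin (k + 1)} {a : Fin (n i - 1)} (ha : a ∉ leftSet f i) :
    ((f ⟨i, a⟩).1 : ℕ) ∈ gap d l i.succ :=
  mem_gap_succ_of_isNeighbor hl (Nat.lt_succ_iff.1 (f ⟨i, a⟩).1.2) (hf ⟨i, a⟩)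
    (lt_of_le_of_ne (not_lt.1 fun h => ha (mem_leftSet.2 h)) ((f ⟨i, a⟩).2 i))

theorem exists_chip (hl : StrictMono l) {f : ExtraChip n ≃ FreePoint d l}
    (hf : f ∈ chipPlacements d l n) {j : Fin (k + 2)} {p : ℕ} (hp : p ∈ gap d l j) :
    ∃ i a, ((f ⟨i, a⟩).1 : ℕ) = p ∧
      ((a ∈ leftSet f i ∧ j = i.castSucc) ∨ (a ∉ leftSet f i ∧ j = i.succ)) := by
  obtain ⟨⟨i, a⟩, hc⟩ := f.surjective
    ⟨⟨p, Nat.lt_succ_iff.2 (mem_gap.1 hp).1⟩, fun i => ne_of_mem_gap hp i⟩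
  have hval : ((f ⟨i, a⟩).1 : ℕ) = p := by rw [hc]
  refine ⟨i, a, hval, ?_⟩
  by_cases ha : a ∈ leftSet f i
  · have := mem_gap_of_mem_leftSet hl hf ha
    rw [hval] at this
    exact Or.inl ⟨ha, gap_unique hp this⟩
  · have := mem_gap_of_notMem_leftSet hl hf ha
    rw [hval] at this
    exact Or.inr ⟨ha, gap_unique hp this⟩

/-- A point of this gap is served either by `l i` from the right or by the preceding occupied point
from the left. -/
theorem image_leftSet (hl : StrictMono l) {f : ExtraChip n ≃ FreePoint d l}
    (hf : f ∈ chipPlacements d l n) (i : Fin (k + 1)) :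
    (leftSet f i).image (fun a => ((f ⟨i, a⟩).1 : ℕ)) =
      gap d l i.castSucc \ fromLeft f i.castSucc := by
  ext p
  rw [Finset.mem_image, Finset.mem_sdiff]
  constructor
  · rintro ⟨a, ha, rfl⟩
    refine ⟨mem_gap_of_mem_leftSet hl hf ha, fun h => ?_⟩
    obtain ⟨_, c, hc, hfc⟩ := mem_fromLeft.1 h
    have := val_injective f hfc
    subst this
    exact i.castSucc_lt_succ.ne' hc
  · rintro ⟨hp, hpB⟩
    obtain ⟨i', a, hval, ⟨ha, hi⟩ | ⟨ha, hi⟩⟩ := exists_chip hl hf hp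
    · obtain rfl := Fin.castSucc_injective _ hi
      exact ⟨a, ha, hval⟩
    · exact absurd (mem_fromLeft.2 ⟨hp, ⟨i', a⟩, hi.symm, hval⟩) hpB

theorem image_compl_leftSet (hl : StrictMono l) {f : ExtraChip n ≃ FreePoint d l}
    (hf : f ∈ chipPlacements d l n) (i : Fin (k + 1)) :
    (leftSet f i)ᶜ.image (fun a => ((f ⟨i, a⟩).1 : ℕ)) = fromLeft f i.succ := by
  ext p
  rw [Finset.mem_image]
  constructor
  · rintro ⟨a, ha, rfl⟩
    rw [Finset.mem_compl] at ha
    exact mem_fromLeft.2 ⟨mem_gap_of_notMem_leftSet hl hf ha, ⟨i, a⟩, rfl, rfl⟩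
  · intro h
    obtain ⟨hp, ⟨i', a⟩, hc, rfl⟩ := mem_fromLeft.1 h
    obtain rfl := Fin.succ_injective _ hc
    refine ⟨a, Finset.mem_compl.2 fun ha => ?_, rfl⟩
    exact i'.castSucc_lt_succ.ne (gap_unique (mem_gap_of_mem_leftSet hl hf ha) hp)

theorem fromLeft_zero (f : ExtraChip n ≃ FreePoint d l) : fromLeft f 0 = ∅ := by
  refine Finset.eq_empty_of_forall_notMem fun p hp => ?_
  obtain ⟨_, c, hc, _⟩ := mem_fromLeft.1 hp
  exact Fin.succ_ne_zero _ hc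

theorem card_leftSet (hl : StrictMono l) {f : ExtraChip n ≃ FreePoint d l}
    (hf : f ∈ chipPlacements d l n) (i : Fin (k + 1)) :
    (leftSet f i).card + (fromLeft f i.castSucc).card = (gap d l i.castSucc).card := by
  have h : Function.Injective fun a => ((f ⟨i, a⟩).1 : ℕ) := fun a b h => by
    simpa using val_injective f h
  rw [← Finset.card_image_of_injective _ h, image_leftSet hl hf,
    Finset.card_sdiff_add_card_eq_card (show fromLeft f _ ⊆ _ from Finset.filter_subset _ _)]

theorem card_fromLeft_succ (hl : StrictMono l) {f : ExtraChip n ≃ FreePoint d l}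
    (hf : f ∈ chipPlacements d l n) (i : Fin (k + 1)) :
    (leftSet f i).card + (fromLeft f i.succ).card = n i - 1 := by
  have h : Function.Injective fun a => ((f ⟨i, a⟩).1 : ℕ) := fun a b h => by
    simpa using val_injective f h
  rw [← image_compl_leftSet hl hf, Finset.card_image_of_injective _ h,
    Finset.card_add_card_compl, Fintype.card_fin]

/-- Counting the points of each gap (`card_leftSet`) and the chips of each occupied point
(`card_fromLeft_succ`) gives the recursion of `chips_unique`. Order plays no role, so a negative
number excludes every placement. -/
theorem card_eq_leftChips (hl : StrictMono l) (hd : ∀ i, l i ≤ d) (hn : ∀ i, 1 ≤ n i)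
    {f : ExtraChip n ≃ FreePoint d l} (hf : f ∈ chipPlacements d l n) (i : Fin (k + 1)) :
    ((leftSet f i).card : ℤ) = leftChips l n i ∧
      ((fromLeft f i.succ).card : ℤ) = rightChips l n i := by
  refine chips_unique l n (y := fun i => ((leftSet f i).card : ℤ))
    (x := fun i => ((fromLeft f i.succ).card : ℤ)) ?_ (fun i => ?_) (fun i => ?_) i
  · have := card_leftSet hl hf 0
    rw [Fin.castSucc_zero, fromLeft_zero, card_gap_zero hl hd] at this
    simpa using this
  · have h1 := card_leftSet hl hf i.succ
    rw [card_gap_succ_castSucc hl hd, ← Fin.succ_castSucc] at h1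
    have := hl i.castSucc_lt_succ
    omega
  · have := card_fromLeft_succ hl hf i
    have := hn i
    omega

/-- A finite set has only one increasing enumeration. This is why ordered placements are determined
by sets alone. -/
theorem eqOn_of_image_eq {m : ℕ} {S : Finset (Fin m)} {g g' : Fin m → ℕ}
    (hg : StrictMonoOn g S) (hg' : StrictMonoOn g' S) (h : S.image g = S.image g') :
    Set.EqOn g g' S := by
  have h1 : StrictMono fun a : S => g a := fun a b hab => hg a.2 b.2 hab
  have h2 : StrictMono fun a : S => g' a := fun a b hab => hg' a.2 b.2 hab
  have hr : ∀ g : Fin m → ℕ, Set.range (fun a : S => g a) = (S.image g : Set ℕ) := by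
    intro g
    ext p
    simp
  have := (h1.range_inj h2).1 (by rw [hr, hr, h])
  intro a ha
  exact congrFun this ⟨a, ha⟩

theorem exists_strictMonoOn {m : ℕ} (S : Finset (Fin m)) (T : Finset ℕ) (h : S.card = T.card) :
    ∃ g : Fin m → ℕ, StrictMonoOn g S ∧ S.image g = T := by
  classical
  let e : S ≃o T := (S.orderIsoOfFin rfl).symm.trans (T.orderIsoOfFin h.symm)
  refine ⟨fun a => if ha : a ∈ S then e ⟨a, ha⟩ else 0, fun a ha b hb hab => ?_, ?_⟩
  · rw [Finset.mem_coe] at ha hb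
    simp only [ha, hb, dif_pos]
    exact e.strictMono hab
  · ext p
    rw [Finset.mem_image]
    constructor
    · rintro ⟨a, ha, rfl⟩
      simp only [ha, dif_pos]
      exact (e ⟨a, ha⟩).2
    · intro hp
      refine ⟨e.symm ⟨p, hp⟩, (e.symm ⟨p, hp⟩).2, ?_⟩
      simp

theorem strictMonoOn_leftSet {f : ExtraChip n ≃ FreePoint d l}
    (hf : f ∈ orderedChipPlacements d l n) (i : Fin (k + 1)) :
    StrictMonoOn (fun a => ((f ⟨i, a⟩).1 : ℕ)) (leftSet f i) := fun a ha b hb hab =>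
  hf.2 i a b hab (iff_of_true (mem_leftSet.1 ha) (mem_leftSet.1 hb))

theorem strictMonoOn_compl_leftSet {f : ExtraChip n ≃ FreePoint d l}
    (hf : f ∈ orderedChipPlacements d l n) (i : Fin (k + 1)) :
    StrictMonoOn (fun a => ((f ⟨i, a⟩).1 : ℕ)) ((leftSet f i)ᶜ : Finset _) := fun a ha b hb hab =>
  hf.2 i a b hab (iff_of_false (fun h => Finset.mem_compl.1 ha (mem_leftSet.2 h))
    (fun h => Finset.mem_compl.1 hb (mem_leftSet.2 h)))

/-- An ordered chip placement is determined by the sides to which the chips go and by the sides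
from which the points are filled. -/
theorem orderedChipPlacements_injOn (hl : StrictMono l) :
    Set.InjOn (fun f : ExtraChip n ≃ FreePoint d l => (leftSet f, fromLeft f))
      (orderedChipPlacements d l n) := by
  intro f hf f' hf' h
  have hA : leftSet f = leftSet f' := congrArg Prod.fst h
  have hB : fromLeft f = fromLeft f' := congrArg Prod.snd h
  refine Equiv.ext fun ⟨i, a⟩ => Subtype.ext (Fin.ext ?_)
  by_cases ha : a ∈ leftSet f i
  · refine eqOn_of_image_eq (g' := fun a => ((f' ⟨i, a⟩).1 : ℕ))
      (strictMonoOn_leftSet hf i) ?_ ?_ ha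
    · rw [hA]; exact strictMonoOn_leftSet hf' i
    · rw [image_leftSet hl hf.1, hA, image_leftSet hl hf'.1, hB]
  · refine eqOn_of_image_eq (g' := fun a => ((f' ⟨i, a⟩).1 : ℕ))
      (strictMonoOn_compl_leftSet hf i) ?_ ?_ (Finset.mem_compl.2 ha)
    · rw [hA]; exact strictMonoOn_compl_leftSet hf' i
    · rw [image_compl_leftSet hl hf.1, hA, image_compl_leftSet hl hf'.1, hB]

/-- Every choice of sides with the right cardinalities comes from an ordered chip placement. -/
theorem exists_orderedChipPlacement (hl : StrictMono l)
    (A : ∀ i, Finset (Fin (n i - 1))) (B : Fin (k + 2) → Finset ℕ) (hB : ∀ j, B j ⊆ gap d l j)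
    (hB0 : B 0 = ∅) (hBl : B (Fin.last _) = gap d l (Fin.last _))
    (hA : ∀ i, (A i).card = (gap d l i.castSucc \ B i.castSucc).card)
    (hAc : ∀ i, ((A i)ᶜ).card = (B i.succ).card) :
    ∃ f ∈ orderedChipPlacements d l n, (leftSet f, fromLeft f) = (A, B) := by
  -- The chips in `A i` are laid in increasing order on the points of the left gap outside `B`, and
  -- the remaining chips of `l i` on the points of the right gap in `B`.
  choose g hg hgA using fun i => exists_strictMonoOn (A i) _ (hA i)
  choose g' hg' hgA' using fun i => exists_strictMonoOn (A i)ᶜ _ (hAc i)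
  obtain ⟨F, hF⟩ : ∃ F : ExtraChip n → ℕ,
      F = fun c => if c.2 ∈ A c.1 then g c.1 c.2 else g' c.1 c.2 :=
    ⟨_, rfl⟩
  have hF1 : ∀ i a, a ∈ A i → F ⟨i, a⟩ = g i a := fun i a ha => by rw [hF]; exact if_pos ha
  have hF2 : ∀ i a, a ∉ A i → F ⟨i, a⟩ = g' i a := fun i a ha => by rw [hF]; exact if_neg ha
  have hL : ∀ i a, a ∈ A i → F ⟨i, a⟩ ∈ gap d l i.castSucc \ B i.castSucc := fun i a ha => by
    rw [hF1 i a ha, ← hgA i]; exact Finset.mem_image_of_mem _ ha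
  have hR : ∀ i a, a ∉ A i → F ⟨i, a⟩ ∈ B i.succ := fun i a ha => by
    rw [hF2 i a ha, ← hgA' i]; exact Finset.mem_image_of_mem _ (Finset.mem_compl.2 ha)
  have hgap : ∀ c, ∃ j, F c ∈ gap d l j := fun ⟨i, a⟩ => by
    by_cases ha : a ∈ A i
    · exact ⟨_, (Finset.mem_sdiff.1 (hL i a ha)).1⟩
    · exact ⟨_, hB _ (hR i a ha)⟩
  have hinj : Function.Injective F := by
    rintro ⟨i, a⟩ ⟨i', a'⟩ h
    by_cases ha : a ∈ A i <;> by_cases ha' : a' ∈ A i'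
    · have h1 := Finset.mem_sdiff.1 (hL i a ha)
      have h2 := Finset.mem_sdiff.1 (hL i' a' ha')
      rw [← h] at h2
      obtain rfl := Fin.castSucc_injective _ (gap_unique h1.1 h2.1)
      rw [hF1 i a ha, hF1 i a' ha'] at h
      rw [(hg i).injOn ha ha' h]
    · have h1 := Finset.mem_sdiff.1 (hL i a ha)
      have h2 := hR i' a' ha'
      rw [← h] at h2
      have := gap_unique h1.1 (hB _ h2)
      rw [this] at h1
      exact absurd h2 h1.2
    · have h1 := Finset.mem_sdiff.1 (hL i' a' ha')
      have h2 := hR i a ha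
      rw [h] at h2
      have := gap_unique h1.1 (hB _ h2)
      rw [this] at h1
      exact absurd h2 h1.2
    · have h1 := hR i a ha
      have h2 := hR i' a' ha'
      rw [← h] at h2
      obtain rfl := Fin.succ_injective _ (gap_unique (hB _ h1) (hB _ h2))
      rw [hF2 i a ha, hF2 i a' ha'] at h
      rw [(hg' i).injOn (Finset.mem_compl.2 ha) (Finset.mem_compl.2 ha') h]
  have hsurjR : ∀ i p, p ∈ B i.succ → ∃ a, a ∉ A i ∧ F ⟨i, a⟩ = p := by
    intro i p hp
    rw [← hgA' i] at hp
    obtain ⟨a, ha, rfl⟩ := Finset.mem_image.1 hp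
    exact ⟨a, Finset.mem_compl.1 ha, hF2 i a (Finset.mem_compl.1 ha)⟩
  -- The conditions on `B` in the first and the last gap enter here: these gaps have an occupied
  -- point on one side only.
  have hsurj : ∀ j p, p ∈ gap d l j → ∃ c, F c = p := by
    intro j p hp
    by_cases hpB : p ∈ B j
    · cases j using Fin.cases with
      | zero => rw [hB0] at hpB; simp at hpB
      | succ i =>
        obtain ⟨a, _, ha⟩ := hsurjR i p hpB
        exact ⟨_, ha⟩
    · cases j using Fin.lastCases with
      | last => rw [hBl] at hpB; exact absurd hp hpB
      | cast i =>
        have : p ∈ (A i).image (g i) := by rw [hgA i]; exact Finset.mem_sdiff.2 ⟨hp, hpB⟩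
        obtain ⟨a, ha, rfl⟩ := Finset.mem_image.1 this
        exact ⟨_, hF1 i a ha⟩
  have hle : ∀ c, F c < d + 1 := fun c => by
    obtain ⟨j, hj⟩ := hgap c
    exact Nat.lt_succ_iff.2 (mem_gap.1 hj).1
  have hfree : ∀ c i, l i ≠ F c := fun c i => by
    obtain ⟨j, hj⟩ := hgap c
    exact ne_of_mem_gap hj i
  let f : ExtraChip n ≃ FreePoint d l := Equiv.ofBijective (fun c => ⟨⟨F c, hle c⟩, hfree c⟩) (by
    constructor
    · intro c c' h
      exact hinj (congrArg (fun p : FreePoint d l => (p.1 : ℕ)) h)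
    · rintro ⟨⟨p, hp⟩, hpf⟩
      obtain ⟨j, hj⟩ := exists_gap hl (Nat.lt_succ_iff.1 hp) hpf
      obtain ⟨c, rfl⟩ := hsurj j p hj
      exact ⟨c, rfl⟩)
  have hfF : ∀ c, ((f c).1 : ℕ) = F c := fun c => rfl
  have hleft : ∀ i a, F ⟨i, a⟩ < l i ↔ a ∈ A i := by
    intro i a
    by_cases ha : a ∈ A i
    · exact iff_of_true (lt_of_mem_gap_castSucc (Finset.mem_sdiff.1 (hL i a ha)).1) ha
    · exact iff_of_false (lt_of_mem_gap_succ (hB _ (hR i a ha))).not_gt ha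
  refine ⟨f, ⟨fun ⟨i, a⟩ => ?_, fun i a b hab h => ?_⟩, Prod.ext (funext fun i => ?_)
    (funext fun j => ?_)⟩
  · rw [hfF]
    by_cases ha : a ∈ A i
    · exact isNeighbor_of_mem_gap_castSucc hl (Finset.mem_sdiff.1 (hL i a ha)).1
    · exact isNeighbor_of_mem_gap_succ hl (hB _ (hR i a ha))
  · rw [hfF, hfF, hleft, hleft] at h
    rw [Fin.lt_def, hfF, hfF]
    by_cases ha : a ∈ A i
    · rw [hF1 i a ha, hF1 i b (h.1 ha)]
      exact hg i ha (h.1 ha) hab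
    · have hb : b ∉ A i := fun hb => ha (h.2 hb)
      rw [hF2 i a ha, hF2 i b hb]
      exact hg' i (Finset.mem_compl.2 ha) (Finset.mem_compl.2 hb) hab
  · ext a
    rw [mem_leftSet, hfF, hleft]
  · ext p
    rw [mem_fromLeft]
    constructor
    · rintro ⟨hp, ⟨i, a⟩, hi, hpF⟩
      rw [hfF] at hpF
      change i.succ = j at hi
      subst hi
      by_cases ha : a ∈ A i
      · have h1 := (Finset.mem_sdiff.1 (hL i a ha)).1
        rw [hpF] at h1
        exact absurd (gap_unique h1 hp) i.castSucc_lt_succ.ne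
      · rw [← hpF]; exact hR i a ha
    · intro hp
      change p ∈ B j at hp
      refine ⟨hB _ hp, ?_⟩
      cases j using Fin.cases with
      | zero => rw [hB0] at hp; simp at hp
      | succ i =>
        obtain ⟨a, _, ha⟩ := hsurjR i p hp
        exact ⟨⟨i, a⟩, rfl, ha⟩

/-- The placements correspond to families of a `y i`-element set among the `n i - 1` extra chips and
of a set of prescribed size in each gap. The first gap receives nothing from the left and the last
gap receives everything from the left, so the two outer gaps contribute the factor one. -/
theorem ncard_orderedChipPlacements (hl : StrictMono l) (hd : ∀ i, l i ≤ d) {x y : Fin (k + 1) → ℕ}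
    (h0 : l 0 = y 0) (hs : ∀ i : Fin k, l i.succ = l i.castSucc + x i.castSucc + y i.succ + 1)
    (hn : ∀ i, n i = y i + x i + 1) (hlast : l (Fin.last k) + x (Fin.last k) = d) :
    (orderedChipPlacements d l n).ncard = (∏ i, (y i + x i).choose (y i)) *
      ∏ i : Fin k, (x i.castSucc + y i.succ).choose (x i.castSucc) := by
  classical
  -- `X j` is the number of points of the `j`-th gap served from the left; the shift by one reflects
  -- that the gap to the right of `l i` has index `i.succ`.
  obtain ⟨X, hX⟩ : ∃ X : Fin (k + 2) → ℕ, X = Fin.cons 0 x := ⟨_, rfl⟩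
  have hX0 : X 0 = 0 := by rw [hX]; rfl
  have hXs : ∀ i, X i.succ = x i := fun i => by rw [hX]; rfl
  have hg0 := card_gap_zero hl hd
  have hgl := card_gap_last (d := d) hl
  have hgs : ∀ i : Fin k, (gap d l i.succ.castSucc).card = x i.castSucc + y i.succ := fun i => by
    rw [card_gap_succ_castSucc hl hd, hs]; omega
  have hgap : ∀ i : Fin (k + 1), (gap d l i.castSucc).card = X i.castSucc + y i := by
    intro i
    cases i using Fin.cases with
    | zero => rw [Fin.castSucc_zero, hg0, hX0, h0, zero_add]
    | succ i => rw [hgs, ← Fin.succ_castSucc, hXs]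
  have himage : (fun f : ExtraChip n ≃ FreePoint d l => (leftSet f, fromLeft f)) ''
      orderedChipPlacements d l n =
      ((Fintype.piFinset fun i => Finset.powersetCard (y i)
          (Finset.univ : Finset (Fin (n i - 1)))) ×ˢ
        (Fintype.piFinset fun j => Finset.powersetCard (X j) (gap d l j)) : Finset _) := by
    ext ⟨A, B⟩
    rw [Finset.mem_coe, Finset.mem_product, Fintype.mem_piFinset, Fintype.mem_piFinset]
    simp only [Finset.mem_powersetCard, Finset.subset_univ, true_and]
    constructor
    · rintro ⟨f, hf, hAB⟩
      obtain ⟨rfl, rfl⟩ : leftSet f = A ∧ fromLeft f = B := Prod.ext_iff.1 hAB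
      have hcard := card_eq_leftChips hl hd (fun i => by rw [hn]; omega) hf.1
      have hxy := chips_unique l n (x := fun i => (x i : ℤ)) (y := fun i => (y i : ℤ))
        (by rw [h0]) (fun i => by rw [hs]; push_cast; ring) (fun i => by rw [hn]; push_cast; ring)
      refine ⟨fun i => ?_, fun j => ⟨Finset.filter_subset _ _, ?_⟩⟩
      · have := (hcard i).1.trans (hxy i).1.symm
        exact_mod_cast this
      · cases j using Fin.cases with
        | zero => rw [hX0, fromLeft_zero, Finset.card_empty]
        | succ i =>
          rw [hXs]
          have := (hcard i).2.trans (hxy i).2.symm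
          exact_mod_cast this
    · rintro ⟨hA, hB⟩
      refine exists_orderedChipPlacement hl A B (fun j => (hB j).1) ?_ ?_ (fun i => ?_) fun i => ?_
      · rw [← Finset.card_eq_zero, (hB 0).2, hX0]
      · refine Finset.eq_of_subset_of_card_le (hB _).1 ?_
        rw [(hB _).2, hgl, ← Fin.succ_last, hXs]
        omega
      · rw [hA, Finset.card_sdiff_of_subset (hB _).1, (hB _).2, hgap]
        omega
      · rw [(hB _).2, hXs, Finset.card_compl, hA, Fintype.card_fin, hn]
        omega
  rw [← (orderedChipPlacements_injOn hl).ncard_image, himage, Set.ncard_coe_finset,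
    Finset.card_product, Fintype.card_piFinset, Fintype.card_piFinset]
  simp only [Finset.card_powersetCard, Finset.card_univ, Fintype.card_fin]
  congr 1
  · exact Finset.prod_congr rfl fun i _ => by rw [hn]; rfl
  · rw [Fin.prod_univ_succ, hX0, Nat.choose_zero_right, one_mul, Fin.prod_univ_castSucc,
      Fin.succ_last, hgl, ← Fin.succ_last, hXs,
      show d - l (Fin.last k) = x (Fin.last k) by omega, Nat.choose_self, mul_one]
    refine Finset.prod_congr rfl fun i _ => ?_
    rw [hXs, Fin.succ_castSucc, hgs]

end Placements

end GrossSchoen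

/-! ### The main theorem -/

open GrossSchoen in
/-- The vertices `v_1 < ⋯ < v_{k+1}` and the exponents are indexed from `0`: `v i` and `n i` are
`v_{i+1}` and `n_{i+1}`, while `y i` is `y_i` and `x i` is `x_{i+1}`. -/
theorem mainTheorem3 (d : ℕ) :
    (∃! deg : chowPiece (cubeGraphs d) (d + 1) ≃ₗ[ℤ] ℤ, IsDegreeMap d deg) ∧
    ∀ deg : chowPiece (cubeGraphs d) (d + 1) ≃ₗ[ℤ] ℤ, IsDegreeMap d deg →
    ∀ (k : ℕ) (v : Fin (k + 1) → Cube d) (n : Fin (k + 1) → ℕ)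
      (_ : StrictMono v) (_ : ∀ i, 1 ≤ n i) (hsum : ∑ i, n i = d + 1),
      (Overflows v n →
        ∏ i, vertexClass (cubeGraphs d) (v i) ^ n i = 0 ∧
        chipPlacements d (fun i => length (v i)) n = ∅) ∧
      (¬ Overflows v n →
        ∃ x y : Fin (k + 1) → ℕ,
          length (v 0) = y 0 ∧
          (∀ i : Fin k,
            length (v i.succ) = length (v i.castSucc) + x i.castSucc + y i.succ + 1) ∧
          (∀ i, n i = y i + x i + 1) ∧
          deg (monomialClass (cubeGraphs d) v n hsum) =
            (-1) ^ (d + 1 - (k + 1)) *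
              (((∏ i, (y i + x i).choose (y i)) *
                ∏ i : Fin k, (x i.castSucc + y i.succ).choose (x i.castSucc) : ℕ) : ℤ) ∧
          (orderedChipPlacements d (fun i => length (v i)) n).ncard =
            (∏ i, (y i + x i).choose (y i)) *
              ∏ i : Fin k, (x i.castSucc + y i.succ).choose (x i.castSucc)) := by
  refine ⟨?_, fun deg hdeg k v n hv hn hsum => ⟨fun hover => ⟨?_, ?_⟩, fun hover => ?_⟩⟩
  · obtain ⟨deg, hdeg⟩ := exists_isDegreeMap d
    refine ⟨deg, hdeg, fun deg' hdeg' => LinearEquiv.ext fun c => ?_⟩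
    rw [hdeg.eq_chowDegree, hdeg'.eq_chowDegree]
  · rw [overflows_iff n v hsum] at hover
    obtain ⟨i, hi⟩ := hover
    -- The degree is injective on the top piece, so one vanishing binomial factor makes the class
    -- vanish.
    have h0 : deg (monomialClass (cubeGraphs d) v n hsum) = 0 := by
      rw [hdeg.eq_chowDegree, monomialClass, chowDegree_prod_vertexClass_pow v n hv hn hsum,
        Finset.prod_eq_zero (Finset.mem_univ i), mul_zero]
      rcases hi with hi | hi
      · rw [binomMix_of_neg_left hi, mul_zero]
      · rw [binomMix_of_neg_right hi, mul_zero]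
    exact congrArg Subtype.val (deg.map_eq_zero_iff.1 h0)
  · rw [overflows_iff n v hsum] at hover
    obtain ⟨i, hi⟩ := hover
    refine Set.eq_empty_of_forall_notMem fun f hf => ?_
    have := card_eq_leftChips (fun i j hij => length_strictMono (hv hij)) (fun i => length_le (v i))
      hn hf i
    omega
  · rw [overflows_iff n v hsum] at hover
    push Not at hover
    obtain ⟨y, hy⟩ : ∃ y : Fin (k + 1) → ℕ, ∀ i, leftChips (fun i => length (v i)) n i = y i :=
      ⟨_, fun i => (Int.toNat_of_nonneg (hover i).1).symm⟩
    obtain ⟨x, hx⟩ : ∃ x : Fin (k + 1) → ℕ, ∀ i, rightChips (fun i => length (v i)) n i = x i :=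
      ⟨_, fun i => (Int.toNat_of_nonneg (hover i).2).symm⟩
    have h0 : length (v 0) = y 0 := by
      have := leftChips_zero (fun i => length (v i)) n
      rw [hy] at this
      omega
    have hs : ∀ i : Fin k,
        length (v i.succ) = length (v i.castSucc) + x i.castSucc + y i.succ + 1 := fun i => by
      have := leftChips_succ (fun i => length (v i)) n i
      rw [hy, hx] at this
      omega
    have hn' : ∀ i, n i = y i + x i + 1 := fun i => by
      have := rightChips_eq (fun i => length (v i)) n i
      rw [hy, hx] at this
      omega
    have hlast : length (v (Fin.last k)) + x (Fin.last k) = d := by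
      have := rightChips_last (fun i => length (v i)) n hsum
      rw [hx] at this
      omega
    refine ⟨x, y, h0, hs, hn', ?_, ncard_orderedChipPlacements
      (fun i j hij => length_strictMono (hv hij)) (fun i => length_le (v i)) h0 hs hn' hlast⟩
    -- The exponents add up to `(d + 1) + (k + 1)`, which has the parity of `(d + 1) - (k + 1)`; the
    -- truncated subtraction is harmless because all multiplicities are at least one.
    have hsign : ∏ i, (-1 : ℤ) ^ (n i + 1) = (-1) ^ (d + 1 - (k + 1)) := by
      rw [Finset.prod_pow_eq_pow_sum, Finset.sum_add_distrib, hsum]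
      have hk : k + 1 ≤ d + 1 := by
        rw [← hsum]
        simpa using Finset.sum_le_sum fun i (_ : i ∈ Finset.univ) => hn i
      simp only [Finset.sum_const, Finset.card_univ, Fintype.card_fin, smul_eq_mul, mul_one]
      rw [show d + 1 + (k + 1) = (d + 1 - (k + 1)) + 2 * (k + 1) by omega, pow_add, pow_mul]
      simp
    rw [hdeg.eq_chowDegree, monomialClass, chowDegree_prod_vertexClass_pow v n hv hn hsum]
    simp only [hx, hy, binomMix_natCast]
    rw [Finset.prod_mul_distrib, hsign]
    push_cast
    ring
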